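/- Let $p>1$ be real, and let $G$ and $H$ be infinite groups with finite symmetric generating sets $S$ and $T$, equipped with the corresponding word metrics $d_G$, $d_H$. For complex-valued functions on $G$ (and likewise on $H$, with $T$ in place of $S$) let $$D_p(G)=\Big\{f:G\to\mathbb C \;\Big|\; \sum_{g\in G}|f(gs^{-1})-f(g)|^p<\infty\ \text{ for all } s\in S\Big\},\qquad \|f\|_{D_p}=\Big(\sum_{s\in S}\sum_{g\in G}|f(gs^{-1})-f(g)|^p+|f(e_G)|^p\Big)^{1/p},$$ let $BD_p(G)$ be the set of bounded functions in $D_p(G)$, and let $B(\overline{\ell^p(G)})_{D_p}$ and $B(\overline{\mathbb CG})_{D_p}$ be the sets of bounded functions in the $\|\cdot\|_{D_p}$-closures in $D_p(G)$ of $\ell^p(G)$ and of the space $\mathbb CG$ of finitely supported functions. Let $BHD_p(G)$ be the set of bounded $h\in D_p(G)$ that are $p$-harmonic, i.e. $\sum_{s\in S}|h(gs^{-1})-h(g)|^{p-2}(h(gs^{-1})-h(g))=0$ for all $g\in G$, where a summand with $h(gs^{-1})=h(g)$ is read as $0$. A $p$-harmonic part of $f\in BD_p(G)$ is an $h\in BHD_p(G)$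 such that $f-h\in B(\overline{\ell^p(G)})_{D_p}$. Let $\varphi:G\to H$ be a rough isometry: there are constants $a\ge 1$, $b\ge 0$, $c>0$ such that $\frac1a d_G(x_1,x_2)-b\le d_H(\varphi(x_1),\varphi(x_2))\le a\,d_G(x_1,x_2)+b$ for all $x_1,x_2\in G$, and for every $y\in H$ there is $x\in G$ with $d_H(\varphi(x),y)<c$. A rough inverse of $\varphi$ is a rough isometry $\psi:H\to G$ such that, for some such constants $a,b,c$ of $\varphi$, $d_G(\psi(\varphi(x)),x)\le a(c+b)$ for all $x\in G$ and $d_H(\varphi(\psi(y)),y)\le c$ for all $y\in H$. Then $\varphi$ has a rough inverse, and there is a bijection $\Phi:BHD_p(G)\to BHD_p(H)$ such that for every rough inverse $\psi$ of $\varphi$ and every $h\in BHD_p(G)$ the function $h\circ\psi$ lies in $BD_p(H)$ and $\Phi(h)$ is a $p$-harmonic part of $h\circ\psi$. If moreover $1_H\notin B(\overline{\mathbb CH})_{D_p}$, then $\Phi(h)$ is the only $p$-harmonic part of $h\circ\psi$, so that $\Phi(h)=\pi(h\circ\psi)$, with $\pi(f)$ denoting the $p$-harmonic part of $f$. -/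

import Mathlib

namespace PHarmonic

/-- A finite symmetric generating set of a group. -/
structure IsSymmGenSet {G : Type*} [Group G] (S : Finset G) : Prop where
  inv_mem : ∀ s ∈ S, s⁻¹ ∈ S
  closure_eq : Subgroup.closure (S : Set G) = ⊤

/-- The word metric: the length of a shortest path in the Cayley graph of `G` with respect to `S`.
In `SimpleGraph.mulCayley S`, two distinct vertices `u`, `v` are joined by an edge if and only if
`u * s = v` or `u = v * s` for some `s ∈ S`. -/
noncomputable def wordDist {G : Type*} [Group G] (S : Finset G) (g₁ g₂ : G) : ℝ :=
  ((SimpleGraph.mulCayley (S : Set G)).dist g₁ g₂ : ℝ)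

/-- `φ` is a rough isometry from `(X, dX)` to `(Y, dY)` with constants `a`, `b`, `c`. -/
structure IsRoughIsometryWith {X Y : Type*} (dX : X → X → ℝ) (dY : Y → Y → ℝ) (a b c : ℝ)
    (φ : X → Y) : Prop where
  one_le : 1 ≤ a
  nonneg : 0 ≤ b
  pos : 0 < c
  lower : ∀ x₁ x₂, 1 / a * dX x₁ x₂ - b ≤ dY (φ x₁) (φ x₂)
  upper : ∀ x₁ x₂, dY (φ x₁) (φ x₂) ≤ a * dX x₁ x₂ + b
  dense : ∀ y, ∃ x, dY (φ x) y < c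

/-- `φ` is a rough isometry from `(X, dX)` to `(Y, dY)`. -/
def IsRoughIsometry {X Y : Type*} (dX : X → X → ℝ) (dY : Y → Y → ℝ) (φ : X → Y) : Prop :=
  ∃ a b c : ℝ, IsRoughIsometryWith dX dY a b c φ

/-- `ψ` is a rough inverse of the rough isometry `φ`. -/
def IsRoughInverse {X Y : Type*} (dX : X → X → ℝ) (dY : Y → Y → ℝ) (φ : X → Y) (ψ : Y → X) :
    Prop :=
  IsRoughIsometry dY dX ψ ∧
    ∃ a b c : ℝ, IsRoughIsometryWith dX dY a b c φ ∧
      (∀ x, dX (ψ (φ x)) x ≤ a * (c + b)) ∧ (∀ y, dY (φ (ψ y)) y ≤ c)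

section FunctionSpaces

variable {G : Type*} [Group G] (p : ℝ) (S : Finset G)

/-- The `p`-Dirichlet finite functions `D_p(G)`. -/
def Dp : Set (G → ℂ) :=
  {f | ∀ s ∈ S, Summable fun g : G => ‖f (g * s⁻¹) - f g‖ ^ p}

/-- The norm of `D_p(G)`, namely `(∑_s ∑_g |f(g s⁻¹) - f(g)|^p + |f(e)|^p)^(1/p)`. -/
noncomputable def dpNorm (f : G → ℂ) : ℝ :=
  ((∑ s ∈ S, ∑' g : G, ‖f (g * s⁻¹) - f g‖ ^ p) + ‖f 1‖ ^ p) ^ (1 / p)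

/-- The closure in `D_p(G)`, for its norm, of a set `A` of elements of `D_p(G)`. -/
def closureDp (A : Set (G → ℂ)) : Set (G → ℂ) :=
  {f | f ∈ Dp p S ∧ ∀ ε > 0, ∃ a ∈ A, a ∈ Dp p S ∧ dpNorm p S (f - a) < ε}

/-- The bounded complex functions on a set. -/
def boundedFun (X : Type*) : Set (X → ℂ) :=
  {f | ∃ C : ℝ, ∀ x, ‖f x‖ ≤ C}

/-- `BD_p(G)`: the bounded functions in `D_p(G)`. -/
def BDp : Set (G → ℂ) := Dp p S ∩ boundedFun G

/-- `ℓ^p` of a set. -/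
def ellp (X : Type*) (p : ℝ) : Set (X → ℂ) :=
  {f | Summable fun x : X => ‖f x‖ ^ p}

/-- The functions with finite support (`ℂG` for `X = G`). -/
def finSupp (X : Type*) : Set (X → ℂ) :=
  {f | (Function.support f).Finite}

/-- The bounded functions in the closure of `ℓ^p(G)` in `D_p(G)`. -/
def BellpClosure : Set (G → ℂ) := closureDp p S (ellp G p) ∩ boundedFun G

/-- The bounded functions in the closure of `ℂG` in `D_p(G)`. -/
def BfinSuppClosure : Set (G → ℂ) := closureDp p S (finSupp G) ∩ boundedFun G

/-- The `p`-Laplacian `∑_s |f(g s⁻¹) - f(g)|^(p-2) (f(g s⁻¹) - f(g))`. A summand with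
`f(g s⁻¹) = f(g)` is `0`, whatever the value of the real power `0 ^ (p - 2)`. -/
noncomputable def pLaplacian (f : G → ℂ) (g : G) : ℂ :=
  ∑ s ∈ S, ((‖f (g * s⁻¹) - f g‖ ^ (p - 2) : ℝ) : ℂ) * (f (g * s⁻¹) - f g)

/-- `HD_p(G)`: the `p`-harmonic functions (which by definition lie in `D_p(G)`). -/
def HDp : Set (G → ℂ) := {f | f ∈ Dp p S ∧ ∀ g, pLaplacian p S f g = 0}

/-- `BHD_p(G)`: the bounded functions in `HD_p(G)`. -/
def BHDp : Set (G → ℂ) := HDp p S ∩ boundedFun G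

/-- `h` is a `p`-harmonic part of `f`: `f = u + h` with `h ∈ BHD_p(G)` and `u` a bounded function
in the closure of `ℓ^p(G)` in `D_p(G)`. -/
def IsHarmonicPart (f h : G → ℂ) : Prop :=
  h ∈ BHDp p S ∧ ∃ u ∈ BellpClosure p S, f = u + h

end FunctionSpaces

end PHarmonic

open PHarmonic

/-! The proof is a nonlinear Royden decomposition combined with the coarse invariance of its
ingredients. Let the energy of a function be the sum of the `p`-th powers of its gradient over the
edges of the Cayley graph, and let N be the closure of the finitely supported functions, which is
also that of `ℓ^p` (`closureDp_ellp`).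

Since `p > 1`, the energy is uniformly convex (`exists_pSum_sub_le`). A minimizing sequence in the
class of a bounded `f` modulo finitely supported functions is therefore Cauchy for the energy, and
truncation keeps it bounded. Its limit is `p`-harmonic and differs from `f` by an element of N
(`exists_harmonic_sub_mem`). Conversely a `p`-harmonic function minimizes the energy in its class
modulo N (`energy_le_energy_add`), so by uniform convexity two of them in the same class differ by a
constant. If `1` is not in N, the constant is zero.

A rough isometry has bounded fibers and moves the ends of an edge to points at bounded distance.
Composition with it thus preserves finite energy and N, while composition with two maps at bounded
distance from each other changes a function of finite energy only by an `ℓ^p` function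
(`comp_sub_mem_ellp`). So modulo N, composition with `ψ` does not depend on the rough inverse `ψ`,
and it is inverse to composition with `φ`. If `1` is not in N on `H`, taking harmonic parts gives
the bijection. Otherwise `1` is in N on both groups, every bounded `p`-harmonic function is constant
(`eq_const_of_one_mem`), and the bijection matches constants. -/

namespace PHarmonic

open Filter Topology
open scoped ENNReal NNReal

/-! ### Sums of `p`-th powers with values in `[0, ∞]` -/

section PowerSums

variable {ι : Type*} {p : ℝ}

/-- The sum of the `p`-th powers of the absolute values of a family of complex numbers. -/
noncomputable def pSum (p : ℝ) (w : ι → ℂ) : ℝ≥0∞ := ∑' i, ‖w i‖ₑ ^ p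

theorem pSum_mono (hp : 0 ≤ p) {v w : ι → ℂ} (h : ∀ i, ‖v i‖ ≤ ‖w i‖) : pSum p v ≤ pSum p w :=
  ENNReal.tsum_le_tsum fun i => ENNReal.rpow_le_rpow (enorm_le_iff_norm_le.2 (h i)) hp

theorem pSum_neg (w : ι → ℂ) : pSum p (-w) = pSum p w := by simp [pSum]

theorem pSum_sub_comm (v w : ι → ℂ) : pSum p (v - w) = pSum p (w - v) := by
  rw [← neg_sub, pSum_neg]

theorem pSum_zero (hp : 0 < p) : pSum p (0 : ι → ℂ) = 0 := by simp [pSum, hp]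

theorem pSum_smul (hp : 0 ≤ p) (c : ℂ) (w : ι → ℂ) : pSum p (c • w) = ‖c‖ₑ ^ p * pSum p w := by
  simp [pSum, enorm_mul, ENNReal.mul_rpow_of_nonneg _ _ hp, ENNReal.tsum_mul_left]

theorem rpow_enorm_le_pSum (w : ι → ℂ) (i : ι) : ‖w i‖ₑ ^ p ≤ pSum p w :=
  ENNReal.le_tsum i

theorem enorm_rpow_eq_ofReal (hp : 0 ≤ p) (z : ℂ) : ‖z‖ₑ ^ p = ENNReal.ofReal (‖z‖ ^ p) := by
  rw [← ofReal_norm, ENNReal.ofReal_rpow_of_nonneg (norm_nonneg _) hp]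

theorem pSum_ne_top_iff (hp : 0 ≤ p) {w : ι → ℂ} :
    pSum p w ≠ ∞ ↔ Summable fun i => ‖w i‖ ^ p := by
  have h0 : ∀ i, 0 ≤ ‖w i‖ ^ p := fun i => by positivity
  constructor
  · intro h
    have := ENNReal.summable_toReal h
    refine this.congr fun i => ?_
    rw [enorm_rpow_eq_ofReal hp, ENNReal.toReal_ofReal (h0 i)]
  · intro h
    simp only [pSum, enorm_rpow_eq_ofReal hp]
    exact h.tsum_ofReal_ne_top

theorem toReal_pSum (hp : 0 ≤ p) (w : ι → ℂ) : (pSum p w).toReal = ∑' i, ‖w i‖ ^ p := by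
  have h0 : ∀ i, 0 ≤ ‖w i‖ ^ p := fun i => by positivity
  rw [pSum, ENNReal.tsum_toReal_eq (fun i => by
    rw [enorm_rpow_eq_ofReal hp]; exact ENNReal.ofReal_ne_top)]
  refine tsum_congr fun i => ?_
  rw [enorm_rpow_eq_ofReal hp, ENNReal.toReal_ofReal (h0 i)]

theorem enorm_add_rpow_le (hp : 1 ≤ p) (a b : ℂ) :
    ‖a + b‖ₑ ^ p ≤ 2 ^ (p - 1) * (‖a‖ₑ ^ p + ‖b‖ₑ ^ p) :=
  (ENNReal.rpow_le_rpow (enorm_add_le a b) (by linarith)).trans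
    (ENNReal.rpow_add_le_mul_rpow_add_rpow _ _ hp)

theorem pSum_add_le (hp : 1 ≤ p) (v w : ι → ℂ) :
    pSum p (v + w) ≤ 2 ^ (p - 1) * (pSum p v + pSum p w) := by
  simp only [pSum, ← ENNReal.tsum_add, ← ENNReal.tsum_mul_left]
  exact ENNReal.tsum_le_tsum fun i => enorm_add_rpow_le hp _ _

theorem two_rpow_ne_top : (2 : ℝ≥0∞) ^ (p - 1) ≠ ∞ :=
  ENNReal.rpow_ne_top_of_ne_zero (by simp) (by simp)

theorem pSum_add_ne_top (hp : 1 ≤ p) {v w : ι → ℂ} (hv : pSum p v ≠ ∞) (hw : pSum p w ≠ ∞) :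
    pSum p (v + w) ≠ ∞ :=
  ne_top_of_le_ne_top (ENNReal.mul_ne_top two_rpow_ne_top (ENNReal.add_ne_top.2 ⟨hv, hw⟩))
    (pSum_add_le hp v w)

theorem pSum_sub_ne_top (hp : 1 ≤ p) {v w : ι → ℂ} (hv : pSum p v ≠ ∞) (hw : pSum p w ≠ ∞) :
    pSum p (v - w) ≠ ∞ := by
  rw [sub_eq_add_neg]
  exact pSum_add_ne_top hp hv (by rwa [pSum_neg])

/-- Minkowski's inequality. -/
theorem pSum_add_rpow_le (hp : 1 ≤ p) (v w : ι → ℂ) :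
    pSum p (v + w) ^ (1 / p) ≤ pSum p v ^ (1 / p) + pSum p w ^ (1 / p) := by
  let _ : MeasurableSpace ι := ⊤
  have h := ENNReal.lintegral_Lp_add_le (μ := MeasureTheory.Measure.count)
    (f := fun i => ‖v i‖ₑ) (g := fun i => ‖w i‖ₑ) (p := p)
    (Measurable.aemeasurable fun _ _ => trivial) (Measurable.aemeasurable fun _ _ => trivial) hp
  simp only [MeasureTheory.lintegral_count] at h
  refine le_trans (ENNReal.rpow_le_rpow (ENNReal.tsum_le_tsum fun i => ?_) (by positivity)) h
  exact ENNReal.rpow_le_rpow (enorm_add_le _ _) (by linarith)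

/-- Fatou's lemma. -/
theorem pSum_le_of_tendsto {α : Type*} {l : Filter α} [l.NeBot] {u : α → ι → ℂ}
    {w : ι → ℂ} {c : ℝ≥0∞} (hu : ∀ i, Tendsto (fun n => u n i) l (𝓝 (w i)))
    (hc : ∀ᶠ n in l, pSum p (u n) ≤ c) : pSum p w ≤ c := by
  rw [pSum, ENNReal.tsum_eq_iSup_sum]
  refine iSup_le fun s => ?_
  refine le_of_tendsto (x := l) (f := fun n => ∑ i ∈ s, ‖u n i‖ₑ ^ p) ?_ ?_
  · refine tendsto_finsetSum _ fun i _ => ?_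
    exact (ENNReal.continuous_rpow_const.tendsto _).comp ((continuous_enorm.tendsto _).comp (hu i))
  · filter_upwards [hc] with n hn
    exact (ENNReal.sum_le_tsum s).trans hn

/-- By Minkowski's inequality the `p`-norm is continuous under convergence in `p`-norm. This
transfers lower bounds to the limit, where Fatou's lemma transfers upper bounds. -/
theorem pSum_tendsto_of_sub_tendsto_zero {α : Type*} {l : Filter α} (hp : 1 ≤ p)
    {u : α → ι → ℂ} {w : ι → ℂ} (hu : Tendsto (fun n => pSum p (u n - w)) l (𝓝 0)) {c : ℝ≥0∞}
    (hc : ∃ᶠ n in l, c ≤ pSum p (u n)) : c ≤ pSum p w := by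
  have hp0 : 0 < 1 / p := by positivity
  have h1 : Tendsto (fun n => pSum p (u n - w) ^ (1 / p) + pSum p w ^ (1 / p)) l
      (𝓝 (0 ^ (1 / p) + pSum p w ^ (1 / p))) :=
    ((ENNReal.continuous_rpow_const.tendsto _).comp hu).add tendsto_const_nhds
  rw [ENNReal.zero_rpow_of_pos hp0, zero_add] at h1
  have h2 : c ^ (1 / p) ≤ pSum p w ^ (1 / p) := by
    refine ge_of_tendsto_of_frequently h1 (hc.mono fun n hn => ?_)
    refine (ENNReal.rpow_le_rpow hn hp0.le).trans ?_
    simpa using pSum_add_rpow_le hp (u n - w) w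
  exact (ENNReal.rpow_le_rpow_iff hp0).1 h2

end PowerSums

/-! ### Uniform convexity of the `p`-norm -/

section UniformConvexity

variable {p : ℝ}

/-- If the norms agree, strict convexity of the disc gives strictness; if they differ, strict
convexity of `t ↦ t ^ p` does. -/
theorem norm_midpoint_rpow_lt (hp : 1 < p) {a b : ℂ} (hab : a ≠ b) :
    ‖(a + b) / 2‖ ^ p < (‖a‖ ^ p + ‖b‖ ^ p) / 2 := by
  by_cases h : ‖a‖ = ‖b‖
  · have h1 : ‖(a + b) / 2‖ < ‖a‖ := by
      have := (not_sameRay_iff_norm_add_lt (x := a) (y := b)).1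
        (fun hs => hab ((sameRay_iff_of_norm_eq h).1 hs))
      rw [norm_div]
      norm_num
      linarith
    have := Real.rpow_lt_rpow (norm_nonneg _) h1 (by linarith : 0 < p)
    rw [← h]; linarith
  · have h1 := (strictConvexOn_rpow hp).2 (norm_nonneg a) (norm_nonneg b) h
      (by norm_num : (0 : ℝ) < 1 / 2) (by norm_num : (0 : ℝ) < 1 / 2) (by norm_num)
    simp only [smul_eq_mul] at h1
    have h2 : ‖(a + b) / 2‖ ≤ 1 / 2 * ‖a‖ + 1 / 2 * ‖b‖ := by
      rw [norm_div]
      have := norm_add_le a b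
      norm_num
      linarith
    have := Real.rpow_le_rpow (norm_nonneg _) h2 (by linarith : 0 ≤ p)
    linarith

/-- A quantitative form of the strict convexity of `‖·‖ ^ p`. -/
theorem exists_norm_sub_rpow_le (hp : 1 < p) {ε : ℝ} (hε : 0 < ε) :
    ∃ C : ℝ, 0 ≤ C ∧ ∀ a b : ℂ, ‖a - b‖ ^ p + C * ‖(a + b) / 2‖ ^ p ≤
      (ε + C / 2) * (‖a‖ ^ p + ‖b‖ ^ p) := by
  have hp0 : 0 < p := by linarith
  -- By homogeneity it suffices to treat normalized pairs. On the compact set of those that are not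
  -- close together, the midpoint gap is at least some `m > 0`.
  let K : Set (ℂ × ℂ) := {x | ‖x.1‖ ^ p + ‖x.2‖ ^ p = 1 ∧ ε ≤ ‖x.1 - x.2‖ ^ p}
  have hc1 : Continuous fun x : ℂ × ℂ => ‖x.1‖ ^ p + ‖x.2‖ ^ p :=
    (continuous_fst.norm.rpow_const fun _ => Or.inr hp0.le).add
      (continuous_snd.norm.rpow_const fun _ => Or.inr hp0.le)
  have hc2 : Continuous fun x : ℂ × ℂ => ‖x.1 - x.2‖ ^ p :=
    (continuous_fst.sub continuous_snd).norm.rpow_const fun _ => Or.inr hp0.le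
  have hc3 : Continuous fun x : ℂ × ℂ => ‖(x.1 + x.2) / 2‖ ^ p :=
    ((continuous_fst.add continuous_snd).div_const 2).norm.rpow_const fun _ => Or.inr hp0.le
  have hle : ∀ x : ℂ × ℂ, ‖x.1‖ ^ p + ‖x.2‖ ^ p = 1 → ‖x.1‖ ≤ 1 ∧ ‖x.2‖ ≤ 1 := by
    intro x hx
    have h1 : 0 ≤ ‖x.1‖ ^ p := by positivity
    have h2 : 0 ≤ ‖x.2‖ ^ p := by positivity
    have h3 : ∀ t : ℝ, 0 ≤ t → t ^ p ≤ 1 → t ≤ 1 := fun t ht h =>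
      (Real.rpow_le_rpow_iff ht zero_le_one hp0).1 (by rwa [Real.one_rpow])
    exact ⟨h3 _ (norm_nonneg _) (by linarith), h3 _ (norm_nonneg _) (by linarith)⟩
  have hK : IsCompact K := by
    refine Metric.isCompact_of_isClosed_isBounded ?_ ?_
    · exact (isClosed_eq hc1 continuous_const).inter (isClosed_le continuous_const hc2)
    · refine (Metric.isBounded_closedBall (x := (0 : ℂ × ℂ)) (r := 1)).subset fun x hx => ?_
      rw [mem_closedBall_zero_iff, Prod.norm_def]
      exact max_le (hle x hx.1).1 (hle x hx.1).2
  obtain ⟨m, hm, hmK⟩ : ∃ m > 0, ∀ x ∈ K,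
      m ≤ (‖x.1‖ ^ p + ‖x.2‖ ^ p) / 2 - ‖(x.1 + x.2) / 2‖ ^ p := by
    rcases K.eq_empty_or_nonempty with h | h
    · exact ⟨1, one_pos, fun x hx => by simp [h] at hx⟩
    · obtain ⟨x, hx, hmin⟩ := hK.exists_isMinOn h
        (((hc1.div_const 2).sub hc3).continuousOn)
      refine ⟨_, ?_, fun y hy => hmin hy⟩
      have hne : x.1 ≠ x.2 := by
        intro h
        have := hx.2
        rw [h, sub_self, norm_zero, Real.zero_rpow hp0.ne'] at this
        linarith
      exact sub_pos.2 (norm_midpoint_rpow_lt hp hne)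
  have hmid : ∀ a b : ℂ, ‖(a + b) / 2‖ ^ p ≤ (‖a‖ ^ p + ‖b‖ ^ p) / 2 := by
    intro a b
    by_cases h : a = b
    · subst h; rw [add_self_div_two]; linarith
    · exact (norm_midpoint_rpow_lt hp h).le
  have hnorm : ∀ a b : ℂ, ‖a‖ ^ p + ‖b‖ ^ p = 1 →
      ‖a - b‖ ^ p + 2 ^ p / m * ‖(a + b) / 2‖ ^ p ≤ ε + 2 ^ p / m / 2 := by
    intro a b hab
    by_cases h : ε ≤ ‖a - b‖ ^ p
    · have h1 := hmK (a, b) ⟨hab, h⟩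
      simp only [hab] at h1
      have h2 : ‖a - b‖ ^ p ≤ 2 ^ p := by
        refine Real.rpow_le_rpow (norm_nonneg _) ((norm_sub_le _ _).trans ?_) hp0.le
        have := hle (a, b) hab
        simp only at this
        linarith
      have h3 : 2 ^ p = 2 ^ p / m * m := by field_simp
      have h4 : 2 ^ p / m * m ≤ 2 ^ p / m * (1 / 2 - ‖(a + b) / 2‖ ^ p) := by gcongr
      linarith
    · have h1 := hmid a b
      rw [hab] at h1
      have h4 : 2 ^ p / m * ‖(a + b) / 2‖ ^ p ≤ 2 ^ p / m * (1 / 2) := by gcongr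
      push Not at h
      linarith
  -- The choice makes `C * m = 2 ^ p`, which dominates `‖a - b‖ ^ p` on normalized pairs in `K`; for
  -- the other pairs the term `ε` suffices.
  refine ⟨2 ^ p / m, by positivity, fun a b => ?_⟩
  set N : ℝ := ‖a‖ ^ p + ‖b‖ ^ p with hN
  have ha0 : 0 ≤ ‖a‖ ^ p := by positivity
  have hb0 : 0 ≤ ‖b‖ ^ p := by positivity
  rcases (by positivity : 0 ≤ N).eq_or_lt with h0 | h0
  · have ha : a = 0 := by
      have : ‖a‖ ^ p = 0 := by linarith
      simpa using (Real.rpow_eq_zero (norm_nonneg _) hp0.ne').1 this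
    have hb : b = 0 := by
      have : ‖b‖ ^ p = 0 := by linarith
      simpa using (Real.rpow_eq_zero (norm_nonneg _) hp0.ne').1 this
    rw [← h0, ha, hb]
    simp [hp0.ne']
  · set r : ℝ := N ^ (-(1 / p)) with hr
    have hr0 : 0 < r := Real.rpow_pos_of_pos h0 _
    have hrp : r ^ p = N⁻¹ := by
      rw [hr, ← Real.rpow_mul h0.le, show -(1 / p) * p = -1 by field_simp, Real.rpow_neg_one]
    have hsc : ∀ z : ℂ, ‖(r : ℂ) * z‖ ^ p = N⁻¹ * ‖z‖ ^ p := by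
      intro z
      rw [norm_mul, Complex.norm_of_nonneg hr0.le, Real.mul_rpow hr0.le (norm_nonneg _), hrp]
    have h1 := hnorm (r * a) (r * b) (by rw [hsc, hsc, ← mul_add, ← hN, inv_mul_cancel₀ h0.ne'])
    rw [← mul_sub, ← mul_add, mul_div_assoc, hsc, hsc] at h1
    have h2 := mul_le_mul_of_nonneg_left h1 h0.le
    have h3 : N * (N⁻¹ * ‖a - b‖ ^ p + 2 ^ p / m * (N⁻¹ * ‖(a + b) / 2‖ ^ p)) =
        ‖a - b‖ ^ p + 2 ^ p / m * ‖(a + b) / 2‖ ^ p := by field_simp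
    rw [h3] at h2
    linarith

/-- The pointwise estimate is linear in `p`-th powers, so it sums over the index set. It plays the
role of Clarkson's inequalities, uniformly in `p > 1`. -/
theorem exists_pSum_sub_le (hp : 1 < p) {ε : ℝ} (hε : 0 < ε) :
    ∃ C : ℝ, 0 ≤ C ∧ ∀ {ι : Type*} (v w : ι → ℂ), pSum p v ≠ ∞ → pSum p w ≠ ∞ →
      (pSum p (v - w)).toReal + C * (pSum p ((1 / 2 : ℂ) • (v + w))).toReal ≤
        (ε + C / 2) * ((pSum p v).toReal + (pSum p w).toReal) := by
  have hp0 : 0 ≤ p := by linarith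
  obtain ⟨C, hC, h⟩ := exists_norm_sub_rpow_le hp hε
  refine ⟨C, hC, fun {ι} v w hv hw => ?_⟩
  have hs := pSum_sub_ne_top hp.le hv hw
  have hm : pSum p ((1 / 2 : ℂ) • (v + w)) ≠ ∞ := by
    rw [pSum_smul hp0]
    exact ENNReal.mul_ne_top (ENNReal.rpow_ne_top_of_nonneg hp0 (by simp))
      (pSum_add_ne_top hp.le hv hw)
  simp only [toReal_pSum hp0]
  rw [pSum_ne_top_iff hp0] at hv hw hs hm
  rw [← hv.tsum_add hw, ← tsum_mul_left, ← tsum_mul_left, ← hs.tsum_add (hm.mul_left C)]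
  refine Summable.tsum_le_tsum (fun i => ?_) (hs.add (hm.mul_left C)) ((hv.add hw).mul_left _)
  have := h (v i) (w i)
  simpa [div_eq_inv_mul] using this

end UniformConvexity

/-! ### A supporting-hyperplane inequality -/

section FirstOrder

variable {p : ℝ}

/-- The first-order lower bound for the convex function `‖·‖ ^ p`. -/
theorem norm_add_rpow_ge (hp : 1 < p) (z w : ℂ) :
    ‖z‖ ^ p + p * (‖z‖ ^ (p - 2) * inner ℝ z w) ≤ ‖z + w‖ ^ p := by
  by_cases hz : z = 0
  · simp only [hz, norm_zero, Real.zero_rpow (by linarith : p ≠ 0), inner_zero_left]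
    have : 0 ≤ ‖(0 : ℂ) + w‖ ^ p := by positivity
    simpa using this
  have hz0 : 0 < ‖z‖ := norm_pos_iff.2 hz
  have hq : (p / (p - 1)).HolderConjugate p :=
    (Real.HolderConjugate.conjExponent hp).symm
  -- Cauchy–Schwarz bounds `‖z‖ ^ (p - 2) * ⟪z, z + w⟫` by the product on the left of Young's
  -- inequality.
  have hy := Real.young_inequality_of_nonneg (a := ‖z‖ ^ (p - 1)) (b := ‖z + w‖)
    (by positivity) (by positivity) hq
  have hp1 : p - 1 ≠ 0 := by linarith
  rw [← Real.rpow_mul hz0.le, show (p - 1) * (p / (p - 1)) = p by field_simp] at hy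
  have e1 : ‖z‖ ^ (p - 1) = ‖z‖ ^ (p - 2) * ‖z‖ := by
    rw [← Real.rpow_add_one hz0.ne']; congr 1; ring
  have e2 : ‖z‖ ^ p = ‖z‖ ^ (p - 2) * (‖z‖ * ‖z‖) := by
    rw [← mul_assoc, ← e1, ← Real.rpow_add_one hz0.ne']; congr 1; ring
  have hi : inner ℝ z (z + w) ≤ ‖z‖ * ‖z + w‖ := real_inner_le_norm _ _
  rw [inner_add_right, real_inner_self_eq_norm_mul_norm] at hi
  have h2 := mul_le_mul_of_nonneg_left hi (by positivity : 0 ≤ ‖z‖ ^ (p - 2))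
  rw [mul_add, ← e2, ← mul_assoc, ← e1] at h2
  have h3 := mul_le_mul_of_nonneg_left (h2.trans hy) (by linarith : 0 ≤ p)
  have h4 : p * (‖z‖ ^ p / (p / (p - 1)) + ‖z + w‖ ^ p / p) = (p - 1) * ‖z‖ ^ p + ‖z + w‖ ^ p := by
    field_simp
  rw [h4] at h3
  linarith

end FirstOrder

/-! ### Energy, the norm of `D_p`, and closures -/

section Energy

variable {G : Type*} [Group G] {p : ℝ} {S : Finset G}

/-- The gradient of a function on the Cayley graph. -/
def grad (S : Finset G) (f : G → ℂ) : S × G → ℂ := fun e => f (e.2 * (e.1 : G)⁻¹) - f e.2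

theorem grad_add (f g : G → ℂ) : grad S (f + g) = grad S f + grad S g := by
  ext e; simp only [grad, Pi.add_apply]; ring

theorem grad_sub (f g : G → ℂ) : grad S (f - g) = grad S f - grad S g := by
  ext e; simp only [grad, Pi.sub_apply]; ring

theorem grad_smul (c : ℂ) (f : G → ℂ) : grad S (c • f) = c • grad S f := by
  ext e; simp only [grad, Pi.smul_apply, smul_eq_mul]; ring

theorem grad_const (c : ℂ) : grad S (fun _ => c) = 0 := by
  ext e; simp [grad]

/-- The `p`-Dirichlet energy. -/
noncomputable def energy (p : ℝ) (S : Finset G) (f : G → ℂ) : ℝ≥0∞ := pSum p (grad S f)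

theorem energy_eq_sum (f : G → ℂ) :
    energy p S f = ∑ s ∈ S, pSum p fun g => f (g * s⁻¹) - f g := by
  rw [energy, pSum, ENNReal.tsum_prod (f := fun (s : S) g => ‖grad S f (s, g)‖ₑ ^ p),
    tsum_fintype]
  exact Finset.sum_coe_sort S fun s => pSum p fun g => f (g * s⁻¹) - f g

theorem mem_Dp_iff (hp : 0 ≤ p) {f : G → ℂ} : f ∈ Dp p S ↔ energy p S f ≠ ∞ := by
  rw [energy_eq_sum, ENNReal.sum_ne_top]
  exact forall₂_congr fun s _ => (pSum_ne_top_iff hp).symm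

/-- The `p`-th power of the norm of `D_p`. -/
noncomputable def dpMod (p : ℝ) (S : Finset G) (f : G → ℂ) : ℝ≥0∞ :=
  energy p S f + ‖f 1‖ₑ ^ p

theorem enorm_rpow_ne_top (hp : 0 ≤ p) (z : ℂ) : ‖z‖ₑ ^ p ≠ ∞ :=
  ENNReal.rpow_ne_top_of_nonneg hp (by simp)

theorem dpMod_eq (hp : 0 < p) {f : G → ℂ} (hf : f ∈ Dp p S) :
    dpMod p S f = ENNReal.ofReal (dpNorm p S f ^ p) := by
  have h0 : ∀ z : ℂ, 0 ≤ ‖z‖ ^ p := fun z => by positivity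
  have h1 : 0 ≤ ∑ s ∈ S, ∑' g : G, ‖f (g * s⁻¹) - f g‖ ^ p :=
    Finset.sum_nonneg fun s _ => tsum_nonneg fun g => h0 _
  rw [dpNorm, ← Real.rpow_mul (add_nonneg h1 (h0 _)), one_div, inv_mul_cancel₀ hp.ne',
    Real.rpow_one, ENNReal.ofReal_add h1 (h0 _), dpMod, energy_eq_sum,
    enorm_rpow_eq_ofReal hp.le, ENNReal.ofReal_sum_of_nonneg fun s _ => tsum_nonneg fun g => h0 _]
  congr 1
  refine Finset.sum_congr rfl fun s hs => ?_
  rw [← toReal_pSum hp.le (fun g => f (g * s⁻¹) - f g),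
    ENNReal.ofReal_toReal ((pSum_ne_top_iff hp.le).2 (hf s hs))]

theorem dpNorm_nonneg (f : G → ℂ) : 0 ≤ dpNorm p S f := by
  have h0 : ∀ z : ℂ, 0 ≤ ‖z‖ ^ p := fun z => by positivity
  have h1 : 0 ≤ ∑ s ∈ S, ∑' g : G, ‖f (g * s⁻¹) - f g‖ ^ p :=
    Finset.sum_nonneg fun s _ => tsum_nonneg fun g => h0 _
  exact Real.rpow_nonneg (add_nonneg h1 (h0 _)) _

theorem energy_sub_ne_top (hp : 1 ≤ p) {f g : G → ℂ} (hf : energy p S f ≠ ∞)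
    (hg : energy p S g ≠ ∞) : energy p S (f - g) ≠ ∞ := by
  rw [energy, grad_sub]; exact pSum_sub_ne_top hp hf hg

theorem energy_add_ne_top (hp : 1 ≤ p) {f g : G → ℂ} (hf : energy p S f ≠ ∞)
    (hg : energy p S g ≠ ∞) : energy p S (f + g) ≠ ∞ := by
  rw [energy, grad_add]; exact pSum_add_ne_top hp hf hg

theorem energy_smul (hp : 0 ≤ p) (c : ℂ) (f : G → ℂ) :
    energy p S (c • f) = ‖c‖ₑ ^ p * energy p S f := by
  rw [energy, grad_smul, pSum_smul hp, energy]

theorem energy_const (hp : 0 < p) (c : ℂ) : energy p S (fun _ => c) = 0 := by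
  rw [energy, grad_const, pSum_zero hp]

theorem dpMod_add_le (hp : 1 ≤ p) (f g : G → ℂ) :
    dpMod p S (f + g) ≤ 2 ^ (p - 1) * (dpMod p S f + dpMod p S g) := by
  simp only [dpMod, energy, grad_add, Pi.add_apply]
  refine (add_le_add (pSum_add_le hp _ _) (enorm_add_rpow_le hp _ _)).trans (le_of_eq ?_)
  ring

theorem dpMod_smul (hp : 0 ≤ p) (c : ℂ) (f : G → ℂ) :
    dpMod p S (c • f) = ‖c‖ₑ ^ p * dpMod p S f := by
  simp only [dpMod, energy_smul hp, Pi.smul_apply, smul_eq_mul, enorm_mul,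
    ENNReal.mul_rpow_of_nonneg _ _ hp, mul_add]

/-- The filter is arbitrary because the limit below is taken along an ultrafilter. -/
theorem mem_closureDp_of_tendsto (hp : 1 ≤ p) {A : Set (G → ℂ)} {f : G → ℂ}
    (hf : energy p S f ≠ ∞) {α : Type*} {l : Filter α} [l.NeBot] {a : α → G → ℂ}
    (haA : ∀ n, a n ∈ A) (haE : ∀ n, energy p S (a n) ≠ ∞)
    (ha : Tendsto (fun n => dpMod p S (f - a n)) l (𝓝 0)) : f ∈ closureDp p S A := by
  have hp0 : 0 < p := by linarith
  refine ⟨(mem_Dp_iff hp0.le).2 hf, fun ε hε => ?_⟩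
  have hε' : 0 < ENNReal.ofReal (ε ^ p) := ENNReal.ofReal_pos.2 (by positivity)
  obtain ⟨n, hn⟩ := (ha.eventually_lt_const hε').exists
  refine ⟨a n, haA n, (mem_Dp_iff hp0.le).2 (haE n), ?_⟩
  rw [dpMod_eq hp0 ((mem_Dp_iff hp0.le).2 (energy_sub_ne_top hp hf (haE n))),
    ENNReal.ofReal_lt_ofReal_iff (by positivity)] at hn
  exact (Real.rpow_lt_rpow_iff (dpNorm_nonneg _) hε.le hp0).1 hn

theorem mem_closureDp_iff (hp : 1 ≤ p) {A : Set (G → ℂ)} {f : G → ℂ} :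
    f ∈ closureDp p S A ↔ energy p S f ≠ ∞ ∧ ∃ a : ℕ → G → ℂ, (∀ n, a n ∈ A) ∧
      (∀ n, energy p S (a n) ≠ ∞) ∧ Tendsto (fun n => dpMod p S (f - a n)) atTop (𝓝 0) := by
  have hp0 : 0 < p := by linarith
  refine ⟨fun ⟨hfD, h⟩ => ?_,
    fun ⟨hf, a, haA, haE, ha⟩ => mem_closureDp_of_tendsto hp hf haA haE ha⟩
  have hf := (mem_Dp_iff hp0.le).1 hfD
  choose a haA haD ha using fun n : ℕ => h (1 / (n + 1)) Nat.one_div_pos_of_nat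
  have haE : ∀ n, energy p S (a n) ≠ ∞ := fun n => (mem_Dp_iff hp0.le).1 (haD n)
  refine ⟨hf, a, haA, haE, ?_⟩
  have h1 : Tendsto (fun n => dpNorm p S (f - a n)) atTop (𝓝 0) :=
    squeeze_zero (fun n => dpNorm_nonneg _) (fun n => (ha n).le)
      tendsto_one_div_add_atTop_nhds_zero_nat
  have h2 := ENNReal.tendsto_ofReal (h1.rpow_const (p := p) (Or.inr hp0.le))
  rw [Real.zero_rpow hp0.ne', ENNReal.ofReal_zero] at h2
  refine h2.congr fun n => (dpMod_eq hp0 ?_).symm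
  exact (mem_Dp_iff hp0.le).2 (energy_sub_ne_top hp hf (haE n))

theorem pSum_mulRight (f : G → ℂ) (y : G) : pSum p (fun g => f (g * y)) = pSum p f :=
  (Equiv.mulRight y).tsum_eq fun g => ‖f g‖ₑ ^ p

theorem exists_energy_le_pSum (hp : 1 ≤ p) (S : Finset G) :
    ∃ C : ℝ≥0∞, C ≠ ∞ ∧ ∀ f : G → ℂ, energy p S f ≤ C * pSum p f := by
  refine ⟨S.card * (2 ^ (p - 1) * 2), ENNReal.mul_ne_top (by simp)
    (ENNReal.mul_ne_top two_rpow_ne_top (by simp)), fun f => ?_⟩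
  rw [energy_eq_sum, mul_assoc, ← nsmul_eq_mul]
  refine Finset.sum_le_card_nsmul _ _ _ fun s _ => ?_
  have := pSum_add_le hp (fun g => f (g * s⁻¹)) (-f)
  rw [pSum_neg, pSum_mulRight, ← two_mul, ← mul_assoc] at this
  refine le_of_eq_of_le (congrArg _ ?_) this
  ext g
  simp [sub_eq_add_neg]

theorem finSupp_subset_ellp (hp : 0 < p) (X : Type*) : finSupp X ⊆ ellp X p := by
  intro f hf
  refine summable_of_hasFiniteSupport (hf.subset fun x hx => ?_)
  simp only [Function.mem_support] at hx ⊢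
  contrapose! hx
  simp [hx, hp.ne']

theorem mem_ellp_iff {X : Type*} (hp : 0 ≤ p) {f : X → ℂ} : f ∈ ellp X p ↔ pSum p f ≠ ∞ :=
  (pSum_ne_top_iff hp).symm

theorem energy_ne_top_of_mem_ellp (hp : 1 ≤ p) {f : G → ℂ} (hf : f ∈ ellp G p) :
    energy p S f ≠ ∞ := by
  obtain ⟨C, hC, h⟩ := exists_energy_le_pSum hp S
  exact ne_top_of_le_ne_top (ENNReal.mul_ne_top hC ((mem_ellp_iff (by linarith)).1 hf)) (h f)

theorem exists_finSupp_pSum_sub_lt {X : Type*} (hp : 0 < p) {f : X → ℂ} (hf : f ∈ ellp X p)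
    {ε : ℝ≥0∞} (hε : 0 < ε) : ∃ b ∈ finSupp X, pSum p (f - b) < ε := by
  classical
  have h := ENNReal.tendsto_tsum_compl_atTop_zero ((mem_ellp_iff hp.le).1 hf)
  obtain ⟨s, hs⟩ := (h.eventually_lt_const hε).exists
  refine ⟨(s : Set X).indicator f, s.finite_toSet.subset Set.support_indicator_subset, ?_⟩
  refine lt_of_eq_of_lt ?_ hs
  rw [pSum, ← (Subtype.val_injective (p := fun x => x ∉ s)).tsum_eq]
  · exact tsum_congr fun x => by simp [x.2]
  · intro x hx
    by_contra h
    simp only [Subtype.range_coe_subtype, Set.mem_ofPred_eq, not_not] at h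
    simp [h, hp] at hx

theorem closureDp_mono {A B : Set (G → ℂ)} (h : A ⊆ B) : closureDp p S A ⊆ closureDp p S B :=
  fun _ hf => ⟨hf.1, fun ε hε => let ⟨a, ha, h'⟩ := hf.2 ε hε; ⟨a, h ha, h'⟩⟩

theorem dpMod_le_of_pSum (hp : 1 ≤ p) (S : Finset G) :
    ∃ C : ℝ≥0∞, C ≠ ∞ ∧ ∀ f : G → ℂ, dpMod p S f ≤ C * pSum p f := by
  obtain ⟨C, hC, h⟩ := exists_energy_le_pSum hp S
  refine ⟨C + 1, by simp [hC], fun f => ?_⟩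
  rw [add_mul, one_mul]
  exact add_le_add (h f) (rpow_enorm_le_pSum f 1)

theorem tendsto_zero_of_le_mul {α : Type*} {l : Filter α} {C : ℝ≥0∞} (hC : C ≠ ∞)
    {u v : α → ℝ≥0∞} (h : ∀ n, v n ≤ C * u n) (hu : Tendsto u l (𝓝 0)) :
    Tendsto v l (𝓝 0) := by
  have := ENNReal.Tendsto.const_mul hu (Or.inr hC)
  rw [mul_zero] at this
  exact tendsto_of_tendsto_of_tendsto_of_le_of_le tendsto_const_nhds this
    (fun _ => bot_le) h

/-- Finitely supported functions are dense in `ℓ^p`, and the `ℓ^p` norm controls the norm of `D_p`.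
-/
theorem closureDp_ellp (hp : 1 ≤ p) : closureDp p S (ellp G p) = closureDp p S (finSupp G) := by
  have hp0 : 0 < p := by linarith
  refine subset_antisymm (fun f hf => ?_) (closureDp_mono (finSupp_subset_ellp hp0 G))
  obtain ⟨hfE, a, haA, haE, ha⟩ := (mem_closureDp_iff hp).1 hf
  obtain ⟨C, hC, hCle⟩ := dpMod_le_of_pSum hp S
  choose b hbs hb using fun n : ℕ => exists_finSupp_pSum_sub_lt hp0 (haA n)
    (ENNReal.inv_pos.2 (ENNReal.natCast_ne_top n))
  refine (mem_closureDp_iff hp).2 ⟨hfE, b, hbs, fun n =>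
    energy_ne_top_of_mem_ellp hp (finSupp_subset_ellp hp0 G (hbs n)), ?_⟩
  have h1 : Tendsto (fun n => dpMod p S (a n - b n)) atTop (𝓝 0) :=
    tendsto_zero_of_le_mul hC (fun n => (hCle _).trans (by gcongr; exact (hb n).le))
      ENNReal.tendsto_inv_nat_nhds_zero
  have h2 := ha.add h1
  rw [add_zero] at h2
  refine tendsto_zero_of_le_mul (two_rpow_ne_top (p := p)) (fun n => ?_) h2
  simpa using dpMod_add_le hp (f - a n) (a n - b n)

theorem ellp_subset_closureDp (hp : 1 ≤ p) : ellp G p ⊆ closureDp p S (finSupp G) := by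
  intro f hf
  rw [← closureDp_ellp hp]
  refine (mem_closureDp_iff hp).2 ⟨energy_ne_top_of_mem_ellp hp hf, fun _ => f, fun _ => hf,
    fun _ => energy_ne_top_of_mem_ellp hp hf, ?_⟩
  simp only [sub_self]
  refine tendsto_const_nhds.congr fun _ => ?_
  have hp0 : 0 < p := by linarith
  have := dpMod_smul (S := S) hp0.le 0 (0 : G → ℂ)
  rw [enorm_zero, ENNReal.zero_rpow_of_pos hp0, zero_mul, zero_smul] at this
  exact this.symm

theorem closureDp_add_mem (hp : 1 ≤ p) {f g : G → ℂ} (hf : f ∈ closureDp p S (finSupp G))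
    (hg : g ∈ closureDp p S (finSupp G)) : f + g ∈ closureDp p S (finSupp G) := by
  obtain ⟨hfE, a, haA, haE, ha⟩ := (mem_closureDp_iff hp).1 hf
  obtain ⟨hgE, b, hbA, hbE, hb⟩ := (mem_closureDp_iff hp).1 hg
  refine (mem_closureDp_iff hp).2 ⟨energy_add_ne_top hp hfE hgE, fun n => a n + b n,
    fun n => ((haA n).union (hbA n)).subset (Function.support_add _ _),
    fun n => energy_add_ne_top hp (haE n) (hbE n), ?_⟩
  have h2 := ha.add hb
  rw [add_zero] at h2
  refine tendsto_zero_of_le_mul (two_rpow_ne_top (p := p)) (fun n => ?_) h2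
  rw [add_sub_add_comm]
  exact dpMod_add_le hp _ _

theorem closureDp_smul_mem (hp : 1 ≤ p) (c : ℂ) {f : G → ℂ}
    (hf : f ∈ closureDp p S (finSupp G)) : c • f ∈ closureDp p S (finSupp G) := by
  have hp0 : 0 ≤ p := by linarith
  obtain ⟨hfE, a, haA, haE, ha⟩ := (mem_closureDp_iff hp).1 hf
  have hs : ∀ g : G → ℂ, energy p S g ≠ ∞ → energy p S (c • g) ≠ ∞ := fun g hg => by
    rw [energy_smul hp0]
    exact ENNReal.mul_ne_top (enorm_rpow_ne_top hp0 c) hg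
  refine (mem_closureDp_iff hp).2 ⟨hs _ hfE, fun n => c • a n,
    fun n => (haA n).subset (Function.support_const_smul_subset c _), fun n => hs _ (haE n), ?_⟩
  refine tendsto_zero_of_le_mul (enorm_rpow_ne_top hp0 c) (fun n => ?_) ha
  rw [← smul_sub, dpMod_smul hp0]

theorem closureDp_sub_mem (hp : 1 ≤ p) {f g : G → ℂ} (hf : f ∈ closureDp p S (finSupp G))
    (hg : g ∈ closureDp p S (finSupp G)) : f - g ∈ closureDp p S (finSupp G) := by
  have := closureDp_add_mem hp hf (closureDp_smul_mem hp (-1) hg)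
  rwa [neg_one_smul, ← sub_eq_add_neg] at this

end Energy

/-! ### Composition with coarse maps -/

section Comparison

variable {G : Type*} [Group G] {p : ℝ} {S : Finset G}

/-- Write `y` as a word in the generators and telescope: each letter costs one gradient sum, since
right translation preserves sums over `G`. -/
theorem exists_pSum_translate_le (hp : 1 ≤ p) (hS : IsSymmGenSet S) (y : G) :
    ∃ C : ℝ≥0∞, C ≠ ∞ ∧ ∀ f : G → ℂ, pSum p (fun g => f (g * y) - f g) ≤ C * energy p S f := by
  have hstep : ∀ s ∈ S, ∀ f : G → ℂ, pSum p (fun g => f (g * s⁻¹) - f g) ≤ energy p S f := by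
    intro s hs f
    rw [energy_eq_sum]
    exact Finset.single_le_sum (f := fun s => pSum p fun g => f (g * s⁻¹) - f g)
      (fun _ _ => bot_le) hs
  have hmul : ∀ x : G, ∀ s ∈ S,
      (∃ C : ℝ≥0∞, C ≠ ∞ ∧ ∀ f : G → ℂ, pSum p (fun g => f (g * x) - f g) ≤ C * energy p S f) →
      ∃ C : ℝ≥0∞, C ≠ ∞ ∧ ∀ f : G → ℂ,
        pSum p (fun g => f (g * (x * s⁻¹)) - f g) ≤ C * energy p S f := by
    rintro x s hs ⟨C, hC, h⟩
    refine ⟨2 ^ (p - 1) * (1 + C), ENNReal.mul_ne_top two_rpow_ne_top (by simp [hC]),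
      fun f => ?_⟩
    have h1 := pSum_add_le hp (fun g => f (g * x * s⁻¹) - f (g * x)) (fun g => f (g * x) - f g)
    rw [pSum_mulRight (fun g => f (g * s⁻¹) - f g) x] at h1
    have h2 : ((fun g => f (g * x * s⁻¹) - f (g * x)) + fun g => f (g * x) - f g) =
        fun g => f (g * (x * s⁻¹)) - f g := by
      ext g; simp [mul_assoc]
    rw [h2] at h1
    refine h1.trans ?_
    rw [mul_assoc, add_mul, one_mul]
    gcongr
    · exact hstep s hs f
    · exact h f
  have hy : y ∈ Subgroup.closure (S : Set G) := by rw [hS.closure_eq]; trivial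
  induction hy using Subgroup.closure_induction_right with
  | one => exact ⟨0, by simp, fun f => by simp [pSum, show 0 < p by linarith]⟩
  | mul_right x _ s hs ih =>
    simpa using hmul x s⁻¹ (hS.inv_mem s hs) ih
  | mul_inv_cancel x _ s hs ih => exact hmul x s hs ih

/-- The fibers of a map have boundedly many elements. -/
def HasBoundedFibers {X Y : Type*} (β : X → Y) : Prop :=
  ∃ (n : ℕ) (k : X → Fin n), Function.Injective fun x => (β x, k x)

theorem HasBoundedFibers.exists_tsum_comp_le {X Y : Type*} {β : X → Y}
    (hβ : HasBoundedFibers β) :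
    ∃ C : ℝ≥0∞, C ≠ ∞ ∧ ∀ F : Y → ℝ≥0∞, ∑' x, F (β x) ≤ C * ∑' y, F y := by
  obtain ⟨n, k, hk⟩ := hβ
  refine ⟨n, ENNReal.natCast_ne_top n, fun F => ?_⟩
  refine (ENNReal.tsum_comp_le_tsum_of_injective hk fun z : Y × Fin n => F z.1).trans ?_
  rw [ENNReal.tsum_prod (f := fun y (_ : Fin n) => F y), ← ENNReal.tsum_mul_left]
  simp

theorem HasBoundedFibers.finite_preimage {X Y : Type*} {β : X → Y}
    (hβ : HasBoundedFibers β) {s : Set Y} (hs : s.Finite) : (β ⁻¹' s).Finite := by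
  obtain ⟨n, k, hk⟩ := hβ
  refine Set.Finite.subset ((hs.prod (Set.finite_univ (α := Fin n))).preimage hk.injOn) ?_
  intro x hx
  exact ⟨hx, trivial⟩

theorem hasBoundedFibers_id (X : Type*) : HasBoundedFibers (fun x : X => x) :=
  ⟨1, fun _ => 0, fun _ _ h => (Prod.ext_iff.1 h).1⟩

/-- The displacement from `β x` to `α x` takes values in the finite set `B`. Summing over all of `B`
reduces to fixed translations, and bounded fibers let the sum over `X` be replaced by one over `G`.
-/
theorem exists_pSum_comp_sub_comp_le (hp : 1 ≤ p) (hS : IsSymmGenSet S) {X : Type*}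
    {α β : X → G} (hβ : HasBoundedFibers β) {B : Finset G} (hB : ∀ x, (β x)⁻¹ * α x ∈ B) :
    ∃ C : ℝ≥0∞, C ≠ ∞ ∧ ∀ f : G → ℂ,
      pSum p (fun x => f (α x) - f (β x)) ≤ C * energy p S f := by
  obtain ⟨C, hC, hCle⟩ := hβ.exists_tsum_comp_le
  choose D hD hDle using exists_pSum_translate_le hp hS
  refine ⟨∑ z ∈ B, C * D z, ENNReal.sum_ne_top.2 fun z _ => ENNReal.mul_ne_top hC (hD z),
    fun f => ?_⟩
  calc pSum p (fun x => f (α x) - f (β x))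
      ≤ ∑' x, ∑ z ∈ B, ‖f (β x * z) - f (β x)‖ₑ ^ p := by
        refine ENNReal.tsum_le_tsum fun x => ?_
        have := Finset.single_le_sum (f := fun z => ‖f (β x * z) - f (β x)‖ₑ ^ p)
          (fun _ _ => bot_le) (hB x)
        simpa using this
    _ = ∑ z ∈ B, ∑' x, ‖f (β x * z) - f (β x)‖ₑ ^ p :=
        Summable.tsum_finsetSum fun _ _ => ENNReal.summable
    _ ≤ ∑ z ∈ B, C * D z * energy p S f := by
        refine Finset.sum_le_sum fun z _ => ?_
        refine (hCle fun y => ‖f (y * z) - f y‖ₑ ^ p).trans ?_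
        rw [mul_assoc]
        exact mul_le_mul_right (hDle z f) C
    _ = _ := by rw [Finset.sum_mul]

variable {H : Type*} [Group H] {T : Finset H}

/-- A map between groups with bounded fibers that moves the ends of an edge of the Cayley graph
to points at bounded distance. -/
structure IsCoarseMap (S : Finset G) (φ : G → H) : Prop where
  fibers : HasBoundedFibers φ
  edges : ∃ B : Finset H, ∀ x, ∀ s ∈ S, (φ x)⁻¹ * φ (x * s⁻¹) ∈ B

theorem IsCoarseMap.exists_energy_comp_le (hp : 1 ≤ p) (hT : IsSymmGenSet T) {φ : G → H}
    (hφ : IsCoarseMap S φ) :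
    ∃ C : ℝ≥0∞, C ≠ ∞ ∧ ∀ f : H → ℂ, energy p S (f ∘ φ) ≤ C * energy p T f := by
  obtain ⟨B, hB⟩ := hφ.edges
  have h : ∀ s : G, ∃ C : ℝ≥0∞, C ≠ ∞ ∧ (s ∈ S → ∀ f : H → ℂ,
      pSum p (fun x => f (φ (x * s⁻¹)) - f (φ x)) ≤ C * energy p T f) := by
    intro s
    by_cases hs : s ∈ S
    · obtain ⟨C, hC, h⟩ := exists_pSum_comp_sub_comp_le hp hT (α := fun x => φ (x * s⁻¹))
        hφ.fibers (fun x => hB x s hs)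
      exact ⟨C, hC, fun _ => h⟩
    · exact ⟨0, by simp, fun h => absurd h hs⟩
  choose C hC hCle using h
  refine ⟨∑ s ∈ S, C s, ENNReal.sum_ne_top.2 fun s _ => hC s, fun f => ?_⟩
  rw [energy_eq_sum, Finset.sum_mul]
  exact Finset.sum_le_sum fun s hs => hCle s hs f

theorem exists_enorm_sub_rpow_le (hp : 1 ≤ p) (hS : IsSymmGenSet S) (x y : G) :
    ∃ C : ℝ≥0∞, C ≠ ∞ ∧ ∀ f : G → ℂ, ‖f x - f y‖ₑ ^ p ≤ C * energy p S f := by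
  obtain ⟨C, hC, h⟩ := exists_pSum_translate_le hp hS (y⁻¹ * x)
  refine ⟨C, hC, fun f => le_trans ?_ (h f)⟩
  have := rpow_enorm_le_pSum (p := p) (fun g => f (g * (y⁻¹ * x)) - f g) y
  simpa using this

/-- Evaluations are continuous on `D_p`. This is needed since composition with `φ` replaces the base
point `1` by `φ 1`. -/
theorem exists_enorm_rpow_le (hp : 1 ≤ p) (hS : IsSymmGenSet S) (x : G) :
    ∃ C : ℝ≥0∞, C ≠ ∞ ∧ ∀ f : G → ℂ, ‖f x‖ₑ ^ p ≤ C * dpMod p S f := by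
  obtain ⟨C, hC, h⟩ := exists_enorm_sub_rpow_le hp hS x 1
  refine ⟨2 ^ (p - 1) * (C + 1), ENNReal.mul_ne_top two_rpow_ne_top (by simp [hC]), fun f => ?_⟩
  have h1 := enorm_add_rpow_le hp (f x - f 1) (f 1)
  rw [sub_add_cancel] at h1
  refine h1.trans ?_
  rw [mul_assoc]
  gcongr
  rw [add_mul, one_mul]
  exact add_le_add ((h f).trans (mul_le_mul_right le_self_add C)) le_add_self

theorem IsCoarseMap.comp_mem_closureDp (hp : 1 ≤ p) (hT : IsSymmGenSet T) {φ : G → H}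
    (hφ : IsCoarseMap S φ) {f : H → ℂ} (hf : f ∈ closureDp p T (finSupp H)) :
    f ∘ φ ∈ closureDp p S (finSupp G) := by
  obtain ⟨hfE, a, haA, haE, ha⟩ := (mem_closureDp_iff hp).1 hf
  obtain ⟨C, hC, hCle⟩ := hφ.exists_energy_comp_le hp hT
  obtain ⟨D, hD, hDle⟩ := exists_enorm_rpow_le hp hT (φ 1)
  have hE : ∀ g : H → ℂ, energy p T g ≠ ∞ → energy p S (g ∘ φ) ≠ ∞ := fun g hg =>
    ne_top_of_le_ne_top (ENNReal.mul_ne_top hC hg) (hCle g)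
  refine (mem_closureDp_iff hp).2 ⟨hE _ hfE, fun n => a n ∘ φ, fun n => ?_,
    fun n => hE _ (haE n), ?_⟩
  · exact hφ.fibers.finite_preimage (haA n)
  · refine tendsto_zero_of_le_mul (C := C + D) (by simp [hC, hD]) (fun n => ?_) ha
    rw [add_mul]
    exact add_le_add ((hCle (f - a n)).trans (mul_le_mul_right le_self_add C)) (hDle (f - a n))

theorem eq_const_of_energy_eq_zero (hp : 1 ≤ p) (hS : IsSymmGenSet S) {f : G → ℂ}
    (hf : energy p S f = 0) (x : G) : f x = f 1 := by
  obtain ⟨C, hC, h⟩ := exists_enorm_sub_rpow_le hp hS x 1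
  have h1 := h f
  rw [hf, mul_zero, nonpos_iff_eq_zero, ENNReal.rpow_eq_zero_iff_of_pos (by linarith),
    enorm_eq_zero, sub_eq_zero] at h1
  exact h1

end Comparison

/-! ### The word metric -/

section WordMetric

variable {G : Type*} [Group G] {S : Finset G}

/-- `SimpleGraph.dist` is `0` between unreachable vertices, so the triangle inequality and the
finiteness of balls rest on connectedness. -/
theorem mulCayley_connected (hS : IsSymmGenSet S) :
    (SimpleGraph.mulCayley (S : Set G)).Connected := by
  have hstep : ∀ x : G, ∀ s ∈ S, (SimpleGraph.mulCayley (S : Set G)).Reachable x (x * s) := by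
    intro x s hs
    by_cases h : x = x * s
    · rw [← h]
    · exact SimpleGraph.Adj.reachable
        ((SimpleGraph.mulCayley_adj _ _ _).2 ⟨h, Or.inl (by simpa using hs)⟩)
  have h1 : ∀ y : G, (SimpleGraph.mulCayley (S : Set G)).Reachable 1 y := by
    intro y
    have hy : y ∈ Subgroup.closure (S : Set G) := by rw [hS.closure_eq]; trivial
    induction hy using Subgroup.closure_induction_right with
    | one => exact SimpleGraph.Reachable.refl _
    | mul_right x _ s hs ih => exact ih.trans (hstep x s hs)
    | mul_inv_cancel x _ s hs ih => exact ih.trans (hstep x s⁻¹ (hS.inv_mem s hs))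
  exact ⟨fun x y => (h1 x).symm.trans (h1 y)⟩

theorem wordDist_triangle (hS : IsSymmGenSet S) (x y z : G) :
    wordDist S x z ≤ wordDist S x y + wordDist S y z := by
  simp only [wordDist]
  exact_mod_cast (mulCayley_connected hS).dist_triangle

theorem wordDist_comm (x y : G) : wordDist S x y = wordDist S y x := by
  simp only [wordDist, SimpleGraph.dist_comm]

theorem wordDist_self (x : G) : wordDist S x x = 0 := by simp [wordDist]

theorem wordDist_mul_inv_le_one {s : G} (hs : s ∈ S) (x : G) : wordDist S (x * s⁻¹) x ≤ 1 := by
  by_cases h : x * s⁻¹ = x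
  · rw [h, wordDist_self]; exact zero_le_one
  · have : (SimpleGraph.mulCayley (S : Set G)).Adj (x * s⁻¹) x :=
      (SimpleGraph.mulCayley_adj _ _ _).2 ⟨h, Or.inl (by simpa using hs)⟩
    rw [wordDist, SimpleGraph.dist_eq_one_iff_adj.2 this, Nat.cast_one]

/-- A walk of length at most `n` spells a word of at most `n` letters of `S`, and there are finitely
many such words. -/
theorem exists_finset_of_wordDist_le (hS : IsSymmGenSet S) (r : ℝ) :
    ∃ B : Finset G, ∀ x y, wordDist S x y ≤ r → x⁻¹ * y ∈ B := by
  classical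
  have h : ∀ n : ℕ, ∃ B : Finset G, ∀ x y, ∀ w : (SimpleGraph.mulCayley (S : Set G)).Walk x y,
      w.length ≤ n → x⁻¹ * y ∈ B := by
    intro n
    induction n with
    | zero =>
      refine ⟨{1}, fun x y w hw => ?_⟩
      rw [SimpleGraph.Walk.eq_of_length_eq_zero (Nat.le_zero.1 hw)]
      simp
    | succ n ih =>
      obtain ⟨B, hB⟩ := ih
      refine ⟨insert 1 ((S ×ˢ B).image fun z => z.1 * z.2), fun x y w hw => ?_⟩
      cases w with
      | nil => simp
      | @cons _ u _ hadj q =>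
        refine Finset.mem_insert_of_mem (Finset.mem_image.2 ⟨(x⁻¹ * u, u⁻¹ * y), ?_, by group⟩)
        rw [SimpleGraph.Walk.length_cons] at hw
        refine Finset.mem_product.2 ⟨?_, hB u y q (by omega)⟩
        rcases ((SimpleGraph.mulCayley_adj _ _ _).1 hadj).2 with h | h
        · exact h
        · simpa using hS.inv_mem _ h
  obtain ⟨n, hn⟩ := exists_nat_ge r
  obtain ⟨B, hB⟩ := h n
  refine ⟨B, fun x y hxy => ?_⟩
  obtain ⟨w, hw⟩ := (mulCayley_connected hS).exists_walk_length_eq_dist x y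
  refine hB x y w ?_
  rw [hw]
  exact Nat.cast_le.1 (hxy.trans hn)

end WordMetric

/-! ### Rough isometries and rough inverses -/

section RoughIsometry

variable {G H : Type*} [Group G] [Group H] {S : Finset G} {T : Finset H} {φ : G → H}

theorem IsRoughIsometryWith.dist_le {X Y : Type*} {dX : X → X → ℝ} {dY : Y → Y → ℝ}
    {a b c : ℝ} {φ : X → Y} (h : IsRoughIsometryWith dX dY a b c φ) (x₁ x₂ : X) :
    dX x₁ x₂ ≤ a * (dY (φ x₁) (φ x₂) + b) := by
  have h0 : 0 < a := lt_of_lt_of_le one_pos h.one_le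
  have h1 := h.lower x₁ x₂
  have h2 : 1 / a * dX x₁ x₂ ≤ dY (φ x₁) (φ x₂) + b := by linarith
  have h3 := mul_le_mul_of_nonneg_left h2 h0.le
  have h4 : a * (1 / a * dX x₁ x₂) = dX x₁ x₂ := by field_simp
  rwa [h4] at h3

theorem IsRoughIsometry.isCoarseMap (hS : IsSymmGenSet S) (hT : IsSymmGenSet T)
    (hφ : IsRoughIsometry (wordDist S) (wordDist T) φ) : IsCoarseMap S φ := by
  obtain ⟨a, b, c, h⟩ := hφ
  constructor
  -- Points of one fiber are at distance at most `a * b`. With a base point `σ y` chosen in each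
  -- nonempty fiber, `x` is recovered from `φ x` and the element `(σ (φ x))⁻¹ * x` of `B`.
  · obtain ⟨B, hB⟩ := exists_finset_of_wordDist_le hS (a * b)
    have hex : ∀ y : H, ∃ x₀ : G, ∀ x, φ x = y → φ x₀ = y := by
      intro y
      by_cases hy : ∃ x, φ x = y
      · exact ⟨hy.choose, fun _ _ => hy.choose_spec⟩
      · exact ⟨1, fun x hx => absurd ⟨x, hx⟩ hy⟩
    choose σ hσ using hex
    have hmem : ∀ x, (σ (φ x))⁻¹ * x ∈ B := by
      intro x
      refine hB _ _ ((h.dist_le _ _).trans_eq ?_)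
      rw [hσ (φ x) x rfl, wordDist_self, zero_add]
    refine ⟨B.card, fun x => B.equivFin ⟨_, hmem x⟩, fun x x' hxx => ?_⟩
    obtain ⟨h1, h2⟩ := Prod.ext_iff.1 hxx
    simp only at h1
    have h3 := congrArg Subtype.val (B.equivFin.injective h2)
    simp only [h1] at h3
    exact mul_left_cancel h3
  · obtain ⟨B, hB⟩ := exists_finset_of_wordDist_le hT (a + b)
    refine ⟨B, fun x s hs => hB _ _ ?_⟩
    rw [wordDist_comm]
    have h0 : 0 ≤ a := zero_le_one.trans h.one_le
    have h1 := mul_le_mul_of_nonneg_left (wordDist_mul_inv_le_one hs x) h0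
    have h2 := h.upper (x * s⁻¹) x
    linarith

theorem IsRoughIsometry.exists_isRoughInverse (hT : IsSymmGenSet T)
    (hφ : IsRoughIsometry (wordDist S) (wordDist T) φ) :
    ∃ ψ : H → G, IsRoughInverse (wordDist S) (wordDist T) φ ψ := by
  obtain ⟨a, b, c, h⟩ := hφ
  choose ψ hψ using h.dense
  have ha := h.one_le
  have hb := h.nonneg
  have hc := h.pos
  have ha0 : 0 < a := by linarith
  have hψφ : ∀ x, wordDist S (ψ (φ x)) x ≤ a * (c + b) := fun x =>
    (h.dist_le _ _).trans (mul_le_mul_of_nonneg_left (by linarith [hψ (φ x)]) ha0.le)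
  -- Replacing `φ (ψ y)` by `y` at both ends costs `2 * c`. In the lower bound the error is `(2 * c
  -- + b) / a`, and `1 / a ≤ a`. The summand `1` makes the density bound strict.
  refine ⟨ψ, ⟨a, a * (2 * c + b), a * (c + b) + 1, ha, by positivity, by positivity,
    fun y₁ y₂ => ?_, fun y₁ y₂ => ?_, fun x => ⟨φ x, by linarith [hψφ x]⟩⟩,
    a, b, c, h, hψφ, fun y => (hψ y).le⟩
  · have h1 := h.upper (ψ y₁) (ψ y₂)
    have h2 := wordDist_triangle hT y₁ (φ (ψ y₁)) y₂
    have h3 := wordDist_triangle hT (φ (ψ y₁)) (φ (ψ y₂)) y₂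
    have h4 := hψ y₁
    have h5 := hψ y₂
    rw [wordDist_comm] at h4
    have h6 : wordDist T y₁ y₂ - (2 * c + b) ≤ a * wordDist S (ψ y₁) (ψ y₂) := by linarith
    have h7 := mul_le_mul_of_nonneg_left h6 (by positivity : 0 ≤ 1 / a)
    have h8 : 1 / a * (a * wordDist S (ψ y₁) (ψ y₂)) = wordDist S (ψ y₁) (ψ y₂) := by field_simp
    have h9 : 1 / a ≤ a := ((div_le_one ha0).2 ha).trans ha
    have h10 := mul_le_mul_of_nonneg_right h9 (by positivity : 0 ≤ 2 * c + b)
    rw [h8, mul_sub] at h7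
    linarith
  · have h1 := h.dist_le (ψ y₁) (ψ y₂)
    have h2 := wordDist_triangle hT (φ (ψ y₁)) y₁ (φ (ψ y₂))
    have h3 := wordDist_triangle hT y₁ y₂ (φ (ψ y₂))
    have h4 := hψ y₁
    have h5 := hψ y₂
    rw [wordDist_comm] at h5
    have h6 : wordDist T (φ (ψ y₁)) (φ (ψ y₂)) + b ≤ wordDist T y₁ y₂ + (2 * c + b) := by linarith
    have h7 := mul_le_mul_of_nonneg_left h6 ha0.le
    rw [mul_add] at h7
    linarith

variable {p : ℝ}

theorem comp_sub_mem_ellp (hp : 1 ≤ p) (hS : IsSymmGenSet S) {X : Type*} {α β : X → G}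
    (hβ : HasBoundedFibers β) {r : ℝ} (hr : ∀ x, wordDist S (α x) (β x) ≤ r) {f : G → ℂ}
    (hf : energy p S f ≠ ∞) : f ∘ α - f ∘ β ∈ ellp X p := by
  obtain ⟨B, hB⟩ := exists_finset_of_wordDist_le hS r
  obtain ⟨C, hC, h⟩ := exists_pSum_comp_sub_comp_le hp hS (α := α) hβ
    (fun x => hB (β x) (α x) (by rw [wordDist_comm]; exact hr x))
  exact (mem_ellp_iff (by linarith)).2
    (ne_top_of_le_ne_top (ENNReal.mul_ne_top hC hf) (h f))

/-- Both `φ (ψ y)` and `φ (ψ' y)` are near `y`, and `φ` cannot bring distant points together. -/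
theorem IsRoughInverse.exists_wordDist_le (hT : IsSymmGenSet T) {ψ ψ' : H → G}
    (hψ : IsRoughInverse (wordDist S) (wordDist T) φ ψ)
    (hψ' : IsRoughInverse (wordDist S) (wordDist T) φ ψ') :
    ∃ r : ℝ, ∀ y, wordDist S (ψ' y) (ψ y) ≤ r := by
  obtain ⟨-, a, b, c, h, -, hc⟩ := hψ
  obtain ⟨-, a', b', c', -, -, hc'⟩ := hψ'
  refine ⟨a * (c' + c + b), fun y => (h.dist_le _ _).trans ?_⟩
  refine mul_le_mul_of_nonneg_left ?_ (zero_le_one.trans h.one_le)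
  have h1 := wordDist_triangle hT (φ (ψ' y)) y (φ (ψ y))
  have h2 := hc y
  rw [wordDist_comm] at h2
  linarith [hc' y]

end RoughIsometry

/-! ### Harmonicity and energy minimization -/

section FirstVariation

variable {G : Type*} [Group G] {p : ℝ} {S : Finset G}

/-- Summation by parts for the `p`-Laplacian. -/
theorem sum_tsum_inner_grad (hS : IsSymmGenSet S) (h : G → ℂ) {v : G → ℂ} (hv : v ∈ finSupp G) :
    ∑ s ∈ S, ∑' g, ‖h (g * s⁻¹) - h g‖ ^ (p - 2) *
        inner ℝ (h (g * s⁻¹) - h g) (v (g * s⁻¹) - v g) =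
      -2 * ∑' g, inner ℝ (pLaplacian p S h g) (v g) := by
  set A : G → G → ℂ := fun s g =>
    ((‖h (g * s⁻¹) - h g‖ ^ (p - 2) : ℝ) : ℂ) * (h (g * s⁻¹) - h g) with hA
  have hsum : ∀ a : G → ℂ, Summable fun g => inner ℝ (a g) (v g) := fun a => by
    refine summable_of_hasFiniteSupport (Set.Finite.subset hv fun g hg => ?_)
    simp only [Function.mem_support] at hg ⊢
    contrapose! hg
    rw [hg, inner_zero_right]
  -- Reversing an edge changes the sign of its flux. With `S` symmetric, both ends of the edges
  -- contribute equally, whence the factor `-2`.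
  have hAneg : ∀ s g, A s (g * s) = -A s⁻¹ g := by
    intro s g
    simp only [hA, mul_inv_cancel_right, inv_inv]
    rw [norm_sub_rev, ← neg_sub (h (g * s)) (h g)]
    ring
  have hreidx : ∀ s, HasSum (fun g => inner ℝ (A s g) (v (g * s⁻¹)))
      (-∑' g, inner ℝ (A s⁻¹ g) (v g)) := by
    intro s
    have h1 : (fun g => inner ℝ (A s g) (v (g * s⁻¹))) ∘ Equiv.mulRight s =
        fun g => -inner ℝ (A s⁻¹ g) (v g) := by
      ext g
      change inner ℝ (A s (g * s)) (v (g * s * s⁻¹)) = _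
      rw [hAneg, mul_inv_cancel_right, inner_neg_left]
    rw [← (Equiv.mulRight s).hasSum_iff, h1, ← tsum_neg]
    exact (hsum (A s⁻¹)).neg.hasSum
  have hterm : ∀ s, ∑' g, ‖h (g * s⁻¹) - h g‖ ^ (p - 2) *
        inner ℝ (h (g * s⁻¹) - h g) (v (g * s⁻¹) - v g) =
      -∑' g, inner ℝ (A s⁻¹ g) (v g) - ∑' g, inner ℝ (A s g) (v g) := by
    intro s
    rw [← ((hreidx s).sub (hsum (A s)).hasSum).tsum_eq]
    refine tsum_congr fun g => ?_
    rw [← inner_sub_right]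
    simp only [hA, ← Complex.real_smul, inner_smul_left]
    simp
  have hinv : ∑ s ∈ S, ∑' g, inner ℝ (A s⁻¹ g) (v g) = ∑ s ∈ S, ∑' g, inner ℝ (A s g) (v g) :=
    Finset.sum_nbij' (fun s => s⁻¹) (fun s => s⁻¹) hS.inv_mem hS.inv_mem
      (fun _ _ => inv_inv _) (fun _ _ => inv_inv _) (fun _ _ => rfl)
  have hlap : ∑ s ∈ S, ∑' g, inner ℝ (A s g) (v g) =
      ∑' g, inner ℝ (pLaplacian p S h g) (v g) := by
    rw [← Summable.tsum_finsetSum fun s _ => hsum (A s)]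
    refine tsum_congr fun g => ?_
    rw [← sum_inner]
    rfl
  rw [Finset.sum_congr rfl fun s _ => hterm s, Finset.sum_sub_distrib, Finset.sum_neg_distrib,
    hinv, hlap]
  ring

theorem finite_support_grad {v : G → ℂ} (hv : v ∈ finSupp G) :
    (Function.support (grad S v)).Finite := by
  have hv' : (Function.support v).Finite := hv
  have h1 : ((Set.univ : Set S) ×ˢ Function.support v).Finite := Set.finite_univ.prod hv'
  have hinj : Function.Injective fun e : S × G => (e.1, e.2 * (e.1 : G)⁻¹) := by
    rintro ⟨s, g⟩ ⟨t, k⟩ h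
    obtain ⟨rfl, h2⟩ := Prod.mk.injEq .. ▸ h
    simpa using h2
  refine (h1.union (h1.preimage hinj.injOn)).subset fun e he => ?_
  simp only [Function.mem_support, grad] at he
  by_cases h : v e.2 = 0
  · refine Or.inr ⟨trivial, fun h' => he ?_⟩
    simp only at h'
    rw [h, h', sub_zero]
  · exact Or.inl ⟨trivial, h⟩

theorem summable_inner_grad (h : G → ℂ) {v : G → ℂ} (hv : v ∈ finSupp G) :
    Summable fun e : S × G => ‖grad S h e‖ ^ (p - 2) * inner ℝ (grad S h e) (grad S v e) := by
  refine summable_of_hasFiniteSupport ((finite_support_grad (S := S) hv).subset fun e he => ?_)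
  simp only [Function.mem_support] at he ⊢
  contrapose! he
  rw [he, inner_zero_right, mul_zero]

theorem tsum_inner_grad (hS : IsSymmGenSet S) (h : G → ℂ) {v : G → ℂ} (hv : v ∈ finSupp G) :
    ∑' e : S × G, ‖grad S h e‖ ^ (p - 2) * inner ℝ (grad S h e) (grad S v e) =
      -2 * ∑' g, inner ℝ (pLaplacian p S h g) (v g) := by
  rw [← sum_tsum_inner_grad hS h hv, (summable_inner_grad h hv).tsum_prod, tsum_fintype]
  exact Finset.sum_coe_sort S fun s => ∑' g, ‖h (g * s⁻¹) - h g‖ ^ (p - 2) *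
        inner ℝ (h (g * s⁻¹) - h g) (v (g * s⁻¹) - v g)

theorem energy_ne_top_of_mem_finSupp (hp : 1 ≤ p) {v : G → ℂ} (hv : v ∈ finSupp G) :
    energy p S v ≠ ∞ :=
  energy_ne_top_of_mem_ellp hp (finSupp_subset_ellp (by linarith) G hv)

theorem energy_le_of_pLaplacian_eq_zero (hp : 1 < p) (hS : IsSymmGenSet S) {h : G → ℂ}
    (hE : energy p S h ≠ ∞) (hh : ∀ g, pLaplacian p S h g = 0) {v : G → ℂ} (hv : v ∈ finSupp G) :
    energy p S h ≤ energy p S (h + v) := by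
  have hp0 : 0 ≤ p := by linarith
  have hE' := energy_add_ne_top hp.le hE (energy_ne_top_of_mem_finSupp hp.le hv)
  rw [← ENNReal.toReal_le_toReal hE hE', energy, energy, toReal_pSum hp0, toReal_pSum hp0]
  rw [energy, pSum_ne_top_iff hp0] at hE hE'
  have hs := (summable_inner_grad (p := p) (S := S) h hv).mul_left p
  have h0 := tsum_inner_grad (p := p) hS h hv
  simp only [hh, inner_zero_left, tsum_zero, mul_zero] at h0
  have h1 : ∑' e : S × G, (‖grad S h e‖ ^ p +
      p * (‖grad S h e‖ ^ (p - 2) * inner ℝ (grad S h e) (grad S v e))) =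
      ∑' e, ‖grad S h e‖ ^ p := by
    rw [hE.tsum_add hs, tsum_mul_left, h0, mul_zero, add_zero]
  rw [← h1]
  refine (hE.add hs).tsum_le_tsum (fun e => ?_) hE'
  rw [grad_add]
  exact norm_add_rpow_ge hp _ _

theorem pLaplacian_eq_zero_of_energy_le (hp : 1 < p) (hS : IsSymmGenSet S) {h : G → ℂ}
    (hE : energy p S h ≠ ∞) (hh : ∀ v ∈ finSupp G, energy p S h ≤ energy p S (h + v)) (g₀ : G) :
    pLaplacian p S h g₀ = 0 := by
  classical
  have hp0 : 0 ≤ p := by linarith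
  -- In this direction the derivative of the energy at `0` is `-2 * p * ‖pLaplacian p S h g₀‖ ^ 2`,
  -- and minimality forces it to vanish. Only the finitely many edges in `F` contribute to the
  -- variation.
  set v : G → ℂ := Pi.single g₀ (pLaplacian p S h g₀) with hvdef
  have hsupp : Function.support v ⊆ {g₀} := Pi.support_single_subset
  have hv : v ∈ finSupp G := (Set.finite_singleton g₀).subset hsupp
  set F := (finite_support_grad (S := S) hv).toFinset with hF
  have hnot : ∀ e, e ∉ F → grad S v e = 0 := fun e he => by simpa [hF] using he
  set f : ℝ → ℝ := fun t => ∑ e ∈ F, ‖grad S h e + t • grad S v e‖ ^ p with hf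
  have hsplit : ∀ t : ℝ, (energy p S (h + (t : ℂ) • v)).toReal =
      f t + ∑' e : {e // e ∉ F}, ‖grad S h e‖ ^ p := by
    intro t
    have hvt : (t : ℂ) • v ∈ finSupp G :=
      Set.Finite.subset hv (Function.support_const_smul_subset _ v)
    have hE' := energy_add_ne_top hp.le hE (energy_ne_top_of_mem_finSupp hp.le hvt)
    rw [energy, pSum_ne_top_iff hp0] at hE'
    rw [energy, toReal_pSum hp0, ← hE'.sum_add_tsum_subtype_compl F]
    simp only [grad_add, grad_smul, Pi.add_apply, Pi.smul_apply]
    congr 1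
    refine tsum_congr fun e => ?_
    rw [hnot e.1 e.2, smul_zero, add_zero]
  have hmin : IsLocalMin f 0 := by
    refine Filter.Eventually.of_forall fun t => ?_
    have hvt : (t : ℂ) • v ∈ finSupp G :=
      Set.Finite.subset hv (Function.support_const_smul_subset _ v)
    have hE' := energy_add_ne_top hp.le hE (energy_ne_top_of_mem_finSupp hp.le hvt)
    have h1 := ENNReal.toReal_mono hE' (hh _ hvt)
    have h2 := hsplit 0
    rw [Complex.ofReal_zero, zero_smul, add_zero] at h2
    rw [h2, hsplit t] at h1
    linarith
  have hderiv : HasDerivAt f (∑ e ∈ F,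
      p * (‖grad S h e‖ ^ (p - 2) * inner ℝ (grad S h e) (grad S v e))) 0 := by
    refine HasDerivAt.fun_sum fun e _ => ?_
    have h1 : HasDerivAt (fun t : ℝ => grad S h e + t • grad S v e) (grad S v e) 0 := by
      simpa using ((hasDerivAt_id (0 : ℝ)).smul_const (grad S v e)).const_add (grad S h e)
    have h2 := (hasFDerivAt_norm_rpow (grad S h e + (0 : ℝ) • grad S v e) hp).comp_hasDerivAt
      (0 : ℝ) h1
    simpa [mul_assoc, Function.comp_def] using h2
  have h0 := hmin.hasDerivAt_eq_zero hderiv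
  rw [← Finset.mul_sum, mul_eq_zero, or_iff_right (by linarith : p ≠ 0)] at h0
  rw [← tsum_eq_sum (L := .unconditional _) fun e he => by
      rw [hnot e he, inner_zero_right, mul_zero],
    tsum_inner_grad hS h hv, tsum_eq_single g₀ fun g hg => by
      rw [hvdef, Pi.single_eq_of_ne hg, inner_zero_right]] at h0
  rw [hvdef, Pi.single_eq_same] at h0
  simpa using h0

/-- A `p`-harmonic function minimizes the energy modulo the closure of the finitely supported
functions. -/
theorem energy_le_energy_add (hp : 1 < p) (hS : IsSymmGenSet S) {h : G → ℂ} (hh : h ∈ HDp p S)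
    {v : G → ℂ} (hv : v ∈ closureDp p S (finSupp G)) : energy p S h ≤ energy p S (h + v) := by
  have hE := (mem_Dp_iff (by linarith)).1 hh.1
  obtain ⟨-, a, haA, -, ha⟩ := (mem_closureDp_iff hp.le).1 hv
  refine pSum_tendsto_of_sub_tendsto_zero (l := atTop) (u := fun n => grad S (h + a n)) hp.le ?_
    (Frequently.of_forall fun n => energy_le_of_pLaplacian_eq_zero hp hS hE hh.2 (haA n))
  refine tendsto_of_tendsto_of_tendsto_of_le_of_le tendsto_const_nhds ha (fun _ => bot_le)
    fun n => ?_
  simp only [← grad_sub, add_sub_add_left_eq_sub]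
  rw [grad_sub, pSum_sub_comm, ← grad_sub]
  exact le_self_add

/-- Each function minimizes the energy in the common class, so they have equal energy `J`, and their
midpoint has energy at least `J`. Uniform convexity then bounds the energy of the difference by `2 *
ε * J` for every `ε > 0`. -/
theorem energy_sub_eq_zero (hp : 1 < p) (hS : IsSymmGenSet S) {h h' : G → ℂ} (hh : h ∈ HDp p S)
    (hh' : h' ∈ HDp p S) (hd : h - h' ∈ closureDp p S (finSupp G)) : energy p S (h - h') = 0 := by
  have hp0 : 0 ≤ p := by linarith
  have hE := (mem_Dp_iff hp0).1 hh.1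
  have hE' := (mem_Dp_iff hp0).1 hh'.1
  have hdE := energy_sub_ne_top hp.le hE hE'
  have hd' : h' - h ∈ closureDp p S (finSupp G) := by
    simpa using closureDp_smul_mem hp.le (-1) hd
  have heq : energy p S h' = energy p S h := by
    refine le_antisymm ?_ ?_
    · simpa using energy_le_energy_add hp hS hh' hd
    · simpa using energy_le_energy_add hp hS hh hd'
  have hmid : energy p S h ≤ energy p S ((1 / 2 : ℂ) • (h + h')) := by
    have h1 := energy_le_energy_add hp hS hh (closureDp_smul_mem hp.le (1 / 2) hd')
    have h2 : h + (1 / 2 : ℂ) • (h' - h) = (1 / 2 : ℂ) • (h + h') := by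
      ext g
      simp only [Pi.add_apply, Pi.smul_apply, Pi.sub_apply, smul_eq_mul]
      ring
    rwa [h2] at h1
  have hmE : energy p S ((1 / 2 : ℂ) • (h + h')) ≠ ∞ := by
    rw [energy_smul hp0]
    exact ENNReal.mul_ne_top (enorm_rpow_ne_top hp0 _) (energy_add_ne_top hp.le hE hE')
  have hmid' := ENNReal.toReal_mono hmE hmid
  set J := (energy p S h).toReal with hJ
  have hJ0 : 0 ≤ J := ENNReal.toReal_nonneg
  have hle : ∀ δ : ℝ, 0 < δ → (energy p S (h - h')).toReal ≤ δ := by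
    intro δ hδ
    obtain ⟨C, hC, hUC⟩ := exists_pSum_sub_le hp (show 0 < δ / (2 * (J + 1)) by positivity)
    have h1 := hUC (grad S h) (grad S h') hE hE'
    rw [← grad_sub, ← grad_add, ← grad_smul] at h1
    change (energy p S (h - h')).toReal + C * (energy p S ((1 / 2 : ℂ) • (h + h'))).toReal ≤
      _ * ((energy p S h).toReal + (energy p S h').toReal) at h1
    rw [heq, ← hJ] at h1
    have h2 := mul_le_mul_of_nonneg_left hmid' hC
    have h3 : δ / (2 * (J + 1)) * (J + J) ≤ δ := by
      rw [div_mul_eq_mul_div, div_le_iff₀ (by positivity)]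
      nlinarith
    linarith
  have h0 := le_antisymm (le_of_forall_pos_le_add fun δ hδ => by simpa using hle δ hδ)
    (ENNReal.toReal_nonneg (a := energy p S (h - h')))
  exact ((ENNReal.toReal_eq_zero_iff _).1 h0).resolve_right hdE

end FirstVariation

/-! ### Truncation -/

section Truncation

/-- Truncation of the real and the imaginary part of a complex number at height `M`. -/
noncomputable def clip (M : ℝ) (z : ℂ) : ℂ := ⟨max (-M) (min M z.re), max (-M) (min M z.im)⟩

theorem norm_clip_sub_le (M : ℝ) (z w : ℂ) : ‖clip M z - clip M w‖ ≤ ‖z - w‖ := by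
  have h : ∀ x y : ℝ, |max (-M) (min M x) - max (-M) (min M y)| ≤ |x - y| := fun x y =>
    (abs_max_sub_max_le_max (-M) _ (-M) _).trans (max_le (by simp)
      ((abs_min_sub_min_le_max M x M y).trans (max_le (by simp) le_rfl)))
  have h' : ∀ x y : ℝ, (max (-M) (min M x) - max (-M) (min M y)) ^ 2 ≤ (x - y) ^ 2 :=
    fun x y => sq_le_sq.2 (h x y)
  rw [← sq_le_sq₀ (norm_nonneg _) (norm_nonneg _), Complex.sq_norm, Complex.sq_norm,
    Complex.normSq_apply, Complex.normSq_apply]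
  simp only [Complex.sub_re, Complex.sub_im, clip, ← sq]
  exact add_le_add (h' _ _) (h' _ _)

theorem clip_eq_self {M : ℝ} {z : ℂ} (h : ‖z‖ ≤ M) : clip M z = z := by
  have h1 := abs_le.1 ((Complex.abs_re_le_norm z).trans h)
  have h2 := abs_le.1 ((Complex.abs_im_le_norm z).trans h)
  apply Complex.ext <;> simp [clip, h1.1, h1.2, h2.1, h2.2]

theorem norm_clip_le {M : ℝ} (hM : 0 ≤ M) (z : ℂ) : ‖clip M z‖ ≤ 2 * M := by
  have h : ∀ x : ℝ, |max (-M) (min M x)| ≤ M := fun x =>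
    abs_le.2 ⟨le_max_left _ _, max_le (by linarith) (min_le_left _ _)⟩
  have := Complex.norm_le_abs_re_add_abs_im (clip M z)
  have h1 := h z.re
  have h2 := h z.im
  simp only [clip] at this ⊢
  linarith

variable {G : Type*} [Group G] {p : ℝ} {S : Finset G}

theorem energy_clip_le (hp : 0 ≤ p) (M : ℝ) (f : G → ℂ) :
    energy p S (clip M ∘ f) ≤ energy p S f :=
  pSum_mono hp fun _ => norm_clip_sub_le _ _ _

end Truncation

/-! ### Existence of the harmonic part -/

section Decomposition

variable {G : Type*} [Group G] {p : ℝ} {S : Finset G}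

theorem finSupp_add {X : Type*} {u v : X → ℂ} (hu : u ∈ finSupp X) (hv : v ∈ finSupp X) :
    u + v ∈ finSupp X := (hu.union hv).subset (Function.support_add _ _)

theorem finSupp_sub {X : Type*} {u v : X → ℂ} (hu : u ∈ finSupp X) (hv : v ∈ finSupp X) :
    u - v ∈ finSupp X := (hu.union hv).subset (Function.support_sub _ _)

/-- A bounded minimizing sequence for the energy in a class modulo finitely supported functions. -/
theorem exists_minimizing_sequence (hp : 1 ≤ p) {f : G → ℂ} (hf : f ∈ BDp p S) :
    ∃ (I : ℝ≥0∞) (M : ℝ) (h : ℕ → G → ℂ), I ≠ ∞ ∧ (∀ u, f - u ∈ finSupp G → I ≤ energy p S u) ∧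
      (∀ n, f - h n ∈ finSupp G) ∧ (∀ n g, ‖h n g‖ ≤ M) ∧
      ∀ n, energy p S (h n) ≤ I + ENNReal.ofReal (1 / (n + 1)) := by
  have hp0 : 0 ≤ p := by linarith
  obtain ⟨hfD, M, hM⟩ := hf
  have hM0 : 0 ≤ M := (norm_nonneg _).trans (hM 1)
  set A : Set (G → ℂ) := {u | f - u ∈ finSupp G} with hA
  set I : ℝ≥0∞ := ⨅ u : A, energy p S u with hI
  have hle : ∀ u, f - u ∈ finSupp G → I ≤ energy p S u := fun u hu =>
    iInf_le (fun u : A => energy p S u) ⟨u, hu⟩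
  have hItop : I ≠ ∞ := ne_top_of_le_ne_top ((mem_Dp_iff hp0).1 hfD)
    (hle f (by simp [finSupp]))
  have hex : ∀ n : ℕ, ∃ u : A, energy p S u < I + ENNReal.ofReal (1 / (n + 1)) := fun n =>
    iInf_lt_iff.1 (ENNReal.lt_add_right hItop
      (ENNReal.ofReal_pos.2 Nat.one_div_pos_of_nat).ne')
  choose u hu using hex
  -- Truncation at height `M` fixes the values of `f`, so it keeps the competitor equal to `f` off a
  -- finite set, without raising its energy.
  refine ⟨I, 2 * M, fun n => clip M ∘ (u n : G → ℂ), hItop, hle, fun n => ?_,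
    fun n g => norm_clip_le hM0 _, fun n => (energy_clip_le hp0 M _).trans (hu n).le⟩
  refine Set.Finite.subset (u n).2 fun g hg => ?_
  simp only [Function.mem_support, Pi.sub_apply, Function.comp_apply] at hg ⊢
  contrapose! hg
  rw [← sub_eq_zero.1 hg, clip_eq_self (hM g), sub_self]

/-- Midpoints of competitors are competitors, so their energy is at least `I`; uniform convexity
then makes the sequence Cauchy. The error splits into `2 * ε * J` and `(2 * ε + C) / (N + 1)`, each
at most `δ / 2`. -/
theorem exists_energy_sub_le_of_minimizing (hp : 1 < p) {f : G → ℂ} {I : ℝ≥0∞} {h : ℕ → G → ℂ}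
    (hI : I ≠ ∞) (hmin : ∀ u, f - u ∈ finSupp G → I ≤ energy p S u)
    (hf : ∀ n, f - h n ∈ finSupp G)
    (hle : ∀ n, energy p S (h n) ≤ I + ENNReal.ofReal (1 / (n + 1))) {δ : ℝ} (hδ : 0 < δ) :
    ∃ N : ℕ, ∀ n ≥ N, ∀ m ≥ N, energy p S (h n - h m) ≤ ENNReal.ofReal δ := by
  have hp0 : 0 ≤ p := by linarith
  have hE : ∀ n, energy p S (h n) ≠ ∞ := fun n =>
    ne_top_of_le_ne_top (ENNReal.add_ne_top.2 ⟨hI, ENNReal.ofReal_ne_top⟩) (hle n)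
  set J := I.toReal with hJ
  have hJ0 : 0 ≤ J := ENNReal.toReal_nonneg
  obtain ⟨C, hC, hUC⟩ := exists_pSum_sub_le hp (show 0 < δ / (4 * (J + 1)) by positivity)
  set ε := δ / (4 * (J + 1)) with hε
  have hε0 : 0 < ε := by positivity
  obtain ⟨N, hN⟩ := exists_nat_one_div_lt (show 0 < δ / (2 * (2 * ε + C)) by positivity)
  refine ⟨N, fun n hn m hm => ?_⟩
  have hreal : ∀ k ≥ N, (energy p S (h k)).toReal ≤ J + 1 / (N + 1) := by
    intro k hk
    have h1 := ENNReal.toReal_mono (ENNReal.add_ne_top.2 ⟨hI, ENNReal.ofReal_ne_top⟩) (hle k)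
    rw [ENNReal.toReal_add hI ENNReal.ofReal_ne_top, ENNReal.toReal_ofReal (by positivity)] at h1
    have h2 : (1 : ℝ) / (k + 1) ≤ 1 / (N + 1) :=
      one_div_le_one_div_of_le (by positivity) (by exact_mod_cast Nat.succ_le_succ hk)
    linarith
  have hmE : energy p S ((1 / 2 : ℂ) • (h n + h m)) ≠ ∞ := by
    rw [energy_smul hp0]
    exact ENNReal.mul_ne_top (enorm_rpow_ne_top hp0 _) (energy_add_ne_top hp.le (hE n) (hE m))
  have hmid : J ≤ (energy p S ((1 / 2 : ℂ) • (h n + h m))).toReal := by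
    refine ENNReal.toReal_mono hmE (hmin _ ?_)
    have h1 : f - (1 / 2 : ℂ) • (h n + h m) = (1 / 2 : ℂ) • ((f - h n) + (f - h m)) := by
      ext g
      simp only [Pi.add_apply, Pi.smul_apply, Pi.sub_apply, smul_eq_mul]
      ring
    rw [h1]
    exact (finSupp_add (hf n) (hf m)).subset (Function.support_const_smul_subset _ _)
  have h1 := hUC (grad S (h n)) (grad S (h m)) (hE n) (hE m)
  rw [← grad_sub, ← grad_add, ← grad_smul] at h1
  change (energy p S (h n - h m)).toReal + C * (energy p S ((1 / 2 : ℂ) • (h n + h m))).toReal ≤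
    _ * ((energy p S (h n)).toReal + (energy p S (h m)).toReal) at h1
  have h2 := mul_le_mul_of_nonneg_left hmid hC
  have h3 : (ε + C / 2) * ((energy p S (h n)).toReal + (energy p S (h m)).toReal) ≤
      (ε + C / 2) * (2 * J + 2 * (1 / (N + 1))) :=
    mul_le_mul_of_nonneg_left (by linarith [hreal n hn, hreal m hm]) (by positivity)
  have h4 : (2 * ε + C) * (1 / (N + 1)) ≤ δ / 2 := by
    have := mul_le_mul_of_nonneg_left hN.le (show 0 ≤ 2 * ε + C by positivity)
    refine this.trans (le_of_eq ?_)
    field_simp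
  have h5 : 2 * ε * J ≤ δ / 2 := by
    rw [hε, mul_div_assoc', div_mul_eq_mul_div, div_le_iff₀ (by positivity)]
    nlinarith
  refine (ENNReal.le_ofReal_iff_toReal_le (energy_sub_ne_top hp.le (hE n) (hE m)) hδ.le).2 ?_
  linarith

/-- Every bounded Dirichlet-finite function is the sum of a bounded `p`-harmonic function and of
an element of the closure of the finitely supported functions. -/
theorem exists_harmonic_sub_mem (hp : 1 < p) (hS : IsSymmGenSet S) {f : G → ℂ}
    (hf : f ∈ BDp p S) : ∃ h ∈ BHDp p S, f - h ∈ closureDp p S (finSupp G) := by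
  have hp0 : 0 ≤ p := by linarith
  have hfE := (mem_Dp_iff hp0).1 hf.1
  obtain ⟨I, M, u, hI, hmin, hfu, hM, hle⟩ := exists_minimizing_sequence hp.le hf
  have huE : ∀ n, energy p S (u n) ≠ ∞ := fun n =>
    ne_top_of_le_ne_top (ENNReal.add_ne_top.2 ⟨hI, ENNReal.ofReal_ne_top⟩) (hle n)
  -- Boundedness gives pointwise limits along an ultrafilter at all `g` at once. Fatou's lemma and
  -- the Cauchy property then give energy convergence along the whole sequence.
  let U : Ultrafilter ℕ := hyperfilter ℕ
  have hU : (U : Filter ℕ) ≤ atTop := Nat.cofinite_eq_atTop ▸ hyperfilter_le_cofinite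
  have hlim : ∀ g, ∃ z : ℂ, ‖z‖ ≤ M ∧ Tendsto (fun n => u n g) U (𝓝 z) := by
    intro g
    obtain ⟨z, hz, hzU⟩ := (isCompact_closedBall (0 : ℂ) M).ultrafilter_le_nhds
      (U.map fun n => u n g) (le_principal_iff.2
        (Ultrafilter.mem_map.2 (Filter.univ_mem' fun n => by simpa using hM n g)))
    exact ⟨z, by simpa using hz, hzU⟩
  choose h hhM hh using hlim
  have hlimgrad : ∀ e : S × G, Tendsto (fun n => grad S (u n) e) U (𝓝 (grad S h e)) :=
    fun e => (hh _).sub (hh _)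
  have hsub : Tendsto (fun n => energy p S (u n - h)) atTop (𝓝 0) := by
    refine ENNReal.tendsto_nhds_zero.2 fun ε hε => ?_
    obtain ⟨δ, -, hδ0, hδε⟩ := ENNReal.lt_iff_exists_real_btwn.1 hε
    obtain ⟨N, hN⟩ := exists_energy_sub_le_of_minimizing hp hI hmin hfu hle
      (ENNReal.ofReal_pos.1 hδ0)
    filter_upwards [eventually_ge_atTop N] with n hn
    refine (pSum_le_of_tendsto (l := (U : Filter ℕ)) (u := fun m => grad S (u n - u m))
      (c := ENNReal.ofReal δ) (fun e => ?_) ?_).trans hδε.le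
    · simp only [grad_sub, Pi.sub_apply]
      exact tendsto_const_nhds.sub (hlimgrad e)
    · exact hU ((eventually_ge_atTop N).mono fun m hm => hN n hn m hm)
  have hhE : energy p S h ≠ ∞ := by
    obtain ⟨n, hn⟩ := (hsub.eventually_lt_const ENNReal.zero_lt_top).exists
    simpa using energy_sub_ne_top hp.le (huE n) hn.ne
  have hhI : energy p S h ≤ I := by
    have h1 : Tendsto (fun n : ℕ => I + ENNReal.ofReal (1 / (n + 1))) atTop (𝓝 I) := by
      have := ENNReal.tendsto_ofReal (tendsto_one_div_add_atTop_nhds_zero_nat (𝕜 := ℝ))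
      simpa using tendsto_const_nhds.add this
    refine ge_of_tendsto' h1 fun N => ?_
    refine pSum_le_of_tendsto (l := (U : Filter ℕ)) hlimgrad (hU ?_)
    filter_upwards [eventually_ge_atTop N] with n hn
    exact (hle n).trans (add_le_add_right (ENNReal.ofReal_le_ofReal
      (one_div_le_one_div_of_le (by positivity) (by exact_mod_cast Nat.succ_le_succ hn))) _)
  refine ⟨h, ⟨⟨(mem_Dp_iff hp0).2 hhE, pLaplacian_eq_zero_of_energy_le hp hS hhE fun v hv => ?_⟩,
    M, hhM⟩, ?_⟩
  -- Each `u n + v` is a competitor, hence has energy at least `I`, and these functions converge in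
  -- energy to `h + v`.
  · refine hhI.trans (pSum_tendsto_of_sub_tendsto_zero (l := atTop)
      (u := fun n => grad S (u n + v)) hp.le ?_ (Frequently.of_forall fun n => hmin _ ?_))
    · simp only [← grad_sub, add_sub_add_right_eq_sub]
      exact hsub
    · rw [← sub_sub]
      exact finSupp_sub (hfu n) hv
  · refine mem_closureDp_of_tendsto hp.le (energy_sub_ne_top hp.le hfE hhE) (l := (U : Filter ℕ))
      (a := fun n => f - u n) hfu (fun n => energy_ne_top_of_mem_finSupp hp.le (hfu n)) ?_
    have h1 : Tendsto (fun n => ‖(u n - h) 1‖ₑ ^ p) U (𝓝 0) := by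
      have h2 := ((ENNReal.continuous_rpow_const (y := p)).tendsto _).comp
        ((continuous_enorm.tendsto _).comp ((hh 1).sub_const (h 1)))
      rw [sub_self, enorm_zero, ENNReal.zero_rpow_of_pos (by linarith)] at h2
      exact h2
    have h3 := (hsub.mono_left hU).add h1
    rw [add_zero] at h3
    simp only [sub_sub_sub_cancel_left]
    exact h3

end Decomposition

/-! ### The case where `1` is a limit of finitely supported functions -/

section Parabolic

variable {p : ℝ}

theorem pSum_tendsto_zero_of_dominated {ι : Type*} (hp : 0 < p) {u : ℕ → ι → ℂ} {B : ι → ℂ}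
    (hB : pSum p B ≠ ∞) (hu : ∀ i, Tendsto (fun n => u n i) atTop (𝓝 0))
    (hle : ∀ n i, ‖u n i‖ ≤ ‖B i‖) : Tendsto (fun n => pSum p (u n)) atTop (𝓝 0) := by
  have h1 : Tendsto (fun n => ∑' i, ‖u n i‖ ^ p) atTop (𝓝 (∑' _ : ι, (0 : ℝ))) := by
    refine tendsto_tsum_of_dominated_convergence ((pSum_ne_top_iff hp.le).1 hB) (fun i => ?_)
      (Eventually.of_forall fun n i => ?_)
    · have := (hu i).norm.rpow_const (p := p) (Or.inr hp.le)
      rwa [norm_zero, Real.zero_rpow hp.ne'] at this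
    · rw [Real.norm_of_nonneg (by positivity)]
      exact Real.rpow_le_rpow (norm_nonneg _) (hle n i) hp.le
  have h2 := ENNReal.tendsto_ofReal h1
  rw [tsum_zero, ENNReal.ofReal_zero] at h2
  refine h2.congr fun n => ?_
  rw [← toReal_pSum hp.le, ENNReal.ofReal_toReal]
  exact ne_top_of_le_ne_top hB (pSum_mono hp.le (hle n))

variable {G : Type*} [Group G] {S : Finset G}

/-- If the constant function `1` is a limit of finitely supported functions, then so is every
bounded Dirichlet-finite function. -/
theorem BDp_subset_closureDp_of_one_mem (hp : 1 < p) (hS : IsSymmGenSet S)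
    (h1 : (1 : G → ℂ) ∈ closureDp p S (finSupp G)) {f : G → ℂ} (hf : f ∈ BDp p S) :
    f ∈ closureDp p S (finSupp G) := by
  have hp0 : 0 < p := by linarith
  obtain ⟨hfD, M, hM⟩ := hf
  have hfE := (mem_Dp_iff hp0.le).1 hfD
  obtain ⟨-, a, haA, -, ha⟩ := (mem_closureDp_iff hp.le).1 h1
  have hone : clip 1 1 = 1 := clip_eq_self (by simp)
  -- The truncations of `a n` serve as bounded cutoffs tending to `1`: `f - f * c n` is `f` times
  -- such a cutoff, and it remains to show that `f * c n` tends to `0`.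
  set c : ℕ → G → ℂ := fun n g => 1 - clip 1 (a n g) with hc
  have hcle : ∀ n g, ‖c n g‖ ≤ ‖(1 - a n) g‖ := fun n g => by
    have := norm_clip_sub_le 1 1 (a n g)
    rwa [hone] at this
  have hcM : ∀ n g, ‖c n g‖ ≤ 3 := fun n g => by
    refine (norm_sub_le _ _).trans ?_
    have := norm_clip_le zero_le_one (a n g)
    rw [norm_one]
    linarith
  have hgrad : ∀ n e, ‖grad S (c n) e‖ ≤ ‖grad S (1 - a n) e‖ := fun n e => by
    simp only [grad, hc, Pi.sub_apply, Pi.one_apply, sub_sub_sub_cancel_left]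
    exact norm_clip_sub_le _ _ _
  have hcE : Tendsto (fun n => energy p S (c n)) atTop (𝓝 0) :=
    tendsto_of_tendsto_of_tendsto_of_le_of_le tendsto_const_nhds ha (fun _ => bot_le)
      fun n => (pSum_mono hp0.le (hgrad n)).trans le_self_add
  have hc0 : ∀ g, Tendsto (fun n => c n g) atTop (𝓝 0) := by
    intro g
    obtain ⟨C, hC, hCle⟩ := exists_enorm_rpow_le hp.le hS g
    have h2 : Tendsto (fun n => ‖c n g‖ₑ ^ p) atTop (𝓝 0) :=
      tendsto_zero_of_le_mul hC (fun n => (ENNReal.rpow_le_rpow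
        (enorm_le_iff_norm_le.2 (hcle n g)) hp0.le).trans (hCle (1 - a n))) ha
    have h3 := ((ENNReal.continuous_rpow_const (y := 1 / p)).tendsto _).comp h2
    rw [ENNReal.zero_rpow_of_pos (by positivity)] at h3
    refine tendsto_zero_iff_enorm_tendsto_zero.2 (h3.congr fun n => ?_)
    simp only [Function.comp_apply]
    rw [← ENNReal.rpow_mul, mul_one_div_cancel hp0.ne', ENNReal.rpow_one]
  have hbA : ∀ n, (f - f * c n) ∈ finSupp G := by
    intro n
    refine Set.Finite.subset (haA n) fun g hg => ?_
    simp only [Function.mem_support, Pi.sub_apply, Pi.mul_apply] at hg ⊢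
    contrapose! hg
    simp [hc, hg, clip_eq_self (show ‖(0 : ℂ)‖ ≤ 1 by simp)]
  refine mem_closureDp_of_tendsto hp.le hfE (l := atTop) (a := fun n => f - f * c n) hbA
    (fun n => energy_ne_top_of_mem_finSupp hp.le (hbA n)) ?_
  simp only [sub_sub_cancel]
  have hA : Tendsto (fun n => pSum p ((M : ℂ) • grad S (c n))) atTop (𝓝 0) :=
    tendsto_zero_of_le_mul (enorm_rpow_ne_top hp0.le (M : ℂ))
      (fun n => (pSum_smul hp0.le _ _).le) hcE
  have hB : Tendsto (fun n => pSum p fun e : S × G => c n e.2 * grad S f e) atTop (𝓝 0) := by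
    refine pSum_tendsto_zero_of_dominated (B := (3 : ℂ) • grad S f) hp0 ?_ (fun e => ?_)
      fun n e => ?_
    · rw [← grad_smul]
      change energy p S _ ≠ ∞
      rw [energy_smul hp0.le]
      exact ENNReal.mul_ne_top (enorm_rpow_ne_top hp0.le _) hfE
    · simpa using (hc0 e.2).mul_const (grad S f e)
    · rw [norm_mul, Pi.smul_apply, norm_smul]
      refine mul_le_mul_of_nonneg_right ((hcM n e.2).trans ?_) (norm_nonneg _)
      norm_num
  have hD : Tendsto (fun n => ‖(f * c n) 1‖ₑ ^ p) atTop (𝓝 0) := by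
    have h2 := ((ENNReal.continuous_rpow_const (y := p)).tendsto _).comp
      ((continuous_enorm.tendsto _).comp ((hc0 1).const_mul (f 1)))
    rw [mul_zero, enorm_zero, ENNReal.zero_rpow_of_pos hp0] at h2
    exact h2
  have hAB := hA.add hB
  rw [add_zero] at hAB
  have hE : Tendsto (fun n => energy p S (f * c n)) atTop (𝓝 0) := by
    refine tendsto_zero_of_le_mul (two_rpow_ne_top (p := p)) (fun n => ?_) hAB
    -- Leibniz rule: the gradient of `f * c n` is `f` at the far end times that of `c n`, plus `c n`
    -- times that of `f`. Boundedness of `f` handles the first term, dominated convergence the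
    -- second.
    refine le_trans ?_ (mul_le_mul_right (add_le_add_left (pSum_mono hp0.le
      (v := fun e : S × G => f (e.2 * (e.1 : G)⁻¹) * grad S (c n) e) fun e => ?_) _) _)
    · refine le_of_eq_of_le (congrArg (pSum p) ?_) (pSum_add_le hp.le _ _)
      ext e
      simp only [grad, Pi.mul_apply, Pi.add_apply]
      ring
    · rw [norm_mul, Pi.smul_apply, norm_smul, Complex.norm_real]
      exact mul_le_mul_of_nonneg_right ((hM _).trans (le_abs_self M)) (norm_nonneg _)
  have := hE.add hD
  rwa [add_zero] at this

/-- Here `-h` is an admissible perturbation of `h`, so the energy of `h` is at most that of `0`. -/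
theorem eq_const_of_one_mem (hp : 1 < p) (hS : IsSymmGenSet S)
    (h1 : (1 : G → ℂ) ∈ closureDp p S (finSupp G)) {h : G → ℂ} (hh : h ∈ BHDp p S) (g : G) :
    h g = h 1 := by
  refine eq_const_of_energy_eq_zero hp.le hS (le_antisymm ?_ bot_le) g
  have h2 := energy_le_energy_add hp hS hh.1 (closureDp_smul_mem hp.le (-1)
    (BDp_subset_closureDp_of_one_mem hp hS h1 ⟨hh.1.1, hh.2⟩))
  rw [neg_one_smul, add_neg_cancel] at h2
  exact h2.trans (energy_const (by linarith) 0).le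

end Parabolic

/-! ### Harmonic parts and their transport -/

section HarmonicPart

variable {G : Type*} [Group G] {p : ℝ} {S : Finset G}

theorem boundedFun_sub {X : Type*} {f g : X → ℂ} (hf : f ∈ boundedFun X) (hg : g ∈ boundedFun X) :
    f - g ∈ boundedFun X := by
  obtain ⟨C, hC⟩ := hf
  obtain ⟨D, hD⟩ := hg
  exact ⟨C + D, fun x => (norm_sub_le _ _).trans (add_le_add (hC x) (hD x))⟩

theorem boundedFun_comp {X Y : Type*} {f : Y → ℂ} (hf : f ∈ boundedFun Y) (φ : X → Y) :
    f ∘ φ ∈ boundedFun X :=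
  let ⟨C, hC⟩ := hf
  ⟨C, fun x => hC (φ x)⟩

theorem isHarmonicPart_iff (hp : 1 ≤ p) {f h : G → ℂ} (hf : f ∈ boundedFun G) :
    IsHarmonicPart p S f h ↔ h ∈ BHDp p S ∧ f - h ∈ closureDp p S (finSupp G) := by
  refine and_congr_right fun hh => ⟨?_, fun h' => ?_⟩
  · rintro ⟨u, hu, rfl⟩
    rw [add_sub_cancel_right, ← closureDp_ellp hp]
    exact hu.1
  · exact ⟨f - h, ⟨by rwa [closureDp_ellp hp], boundedFun_sub hf hh.2⟩, (sub_add_cancel f h).symm⟩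

theorem one_mem_BfinSuppClosure_iff :
    (1 : G → ℂ) ∈ BfinSuppClosure p S ↔ (1 : G → ℂ) ∈ closureDp p S (finSupp G) :=
  and_iff_left ⟨1, fun _ => by simp⟩

/-- The difference is constant, and a nonzero constant in the closure would put `1` there. -/
theorem eq_of_sub_mem_closureDp (hp : 1 < p) (hS : IsSymmGenSet S)
    (h1 : (1 : G → ℂ) ∉ closureDp p S (finSupp G)) {h h' : G → ℂ} (hh : h ∈ BHDp p S)
    (hh' : h' ∈ BHDp p S) (hd : h - h' ∈ closureDp p S (finSupp G)) : h = h' := by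
  have hconst := eq_const_of_energy_eq_zero hp.le hS (energy_sub_eq_zero hp hS hh.1 hh'.1 hd)
  set c := (h - h') 1 with hc
  by_cases hc0 : c = 0
  · ext g
    have := hconst g
    rwa [hc0, Pi.sub_apply, sub_eq_zero] at this
  · refine absurd ?_ h1
    have heq : (1 : G → ℂ) = c⁻¹ • (h - h') := by
      ext g
      rw [Pi.smul_apply, hconst g, Pi.one_apply, smul_eq_mul, inv_mul_cancel₀ hc0]
    rw [heq]
    exact closureDp_smul_mem hp.le c⁻¹ hd

theorem const_mem_BHDp (hp : 0 < p) (c : ℂ) : (fun _ => c) ∈ BHDp p S :=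
  ⟨⟨(mem_Dp_iff hp.le).2 (by rw [energy_const hp]; exact ENNReal.zero_ne_top),
    fun g => by simp [pLaplacian]⟩, ‖c‖, fun _ => le_rfl⟩

theorem mem_BDp_of_mem_BHDp {h : G → ℂ} (hh : h ∈ BHDp p S) : h ∈ BDp p S := ⟨hh.1.1, hh.2⟩

theorem energy_ne_top_of_mem_BHDp (hp : 0 ≤ p) {h : G → ℂ} (hh : h ∈ BHDp p S) :
    energy p S h ≠ ∞ := (mem_Dp_iff hp).1 hh.1.1

theorem zero_mem_closureDp (hp : 1 ≤ p) : (0 : G → ℂ) ∈ closureDp p S (finSupp G) :=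
  ellp_subset_closureDp hp (finSupp_subset_ellp (by linarith) G (by simp [finSupp]))

variable {H : Type*} [Group H] {T : Finset H}

theorem IsCoarseMap.comp_mem_BDp (hp : 1 ≤ p) (hS : IsSymmGenSet S) {ψ : H → G}
    (hψ : IsCoarseMap T ψ) {f : G → ℂ} (hf : f ∈ BDp p S) : f ∘ ψ ∈ BDp p T := by
  have hp0 : 0 ≤ p := by linarith
  obtain ⟨C, hC, h⟩ := hψ.exists_energy_comp_le hp hS
  exact ⟨(mem_Dp_iff hp0).2 (ne_top_of_le_ne_top
    (ENNReal.mul_ne_top hC ((mem_Dp_iff hp0).1 hf.1)) (h f)), boundedFun_comp hf.2 ψ⟩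

theorem IsCoarseMap.one_mem_closureDp (hp : 1 ≤ p) (hT : IsSymmGenSet T) {φ : G → H}
    (hφ : IsCoarseMap S φ) (h : (1 : H → ℂ) ∈ closureDp p T (finSupp H)) :
    (1 : G → ℂ) ∈ closureDp p S (finSupp G) := by
  have h1 := hφ.comp_mem_closureDp hp hT h
  rwa [Pi.one_comp] at h1

/-- In the case where `1` is not a limit of finitely supported functions, taking the harmonic part
of the composition with `ψ` is a bijection, if `ψ` has a rough inverse `φ`. -/
theorem bijective_of_comp_sub_mem (hp : 1 < p) (hS : IsSymmGenSet S) (hT : IsSymmGenSet T)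
    (h1 : (1 : H → ℂ) ∉ closureDp p T (finSupp H)) {φ : G → H} {ψ : H → G}
    (hφ : IsCoarseMap S φ) (hψ : IsCoarseMap T ψ)
    {r r' : ℝ} (hψφ : ∀ x, wordDist S (ψ (φ x)) x ≤ r) (hφψ : ∀ y, wordDist T (φ (ψ y)) y ≤ r')
    {Φ : BHDp p S → BHDp p T}
    (hΦ : ∀ h : BHDp p S, (h : G → ℂ) ∘ ψ - (Φ h : H → ℂ) ∈ closureDp p T (finSupp H)) :
    Function.Bijective Φ := by
  have hp0 : 0 ≤ p := by linarith
  have h1G : (1 : G → ℂ) ∉ closureDp p S (finSupp G) := fun h =>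
    h1 (hψ.one_mem_closureDp hp.le hS h)
  constructor
  · intro h h' hh
    have hd : (h - h' : G → ℂ) ∘ ψ ∈ closureDp p T (finSupp H) := by
      have := closureDp_sub_mem hp.le (hΦ h) (hΦ h')
      rwa [hh, sub_sub_sub_cancel_right, ← Pi.sub_comp] at this
    have hd' := hφ.comp_mem_closureDp hp.le hT hd
    have hE : energy p S (h - h' : G → ℂ) ≠ ∞ :=
      energy_sub_ne_top hp.le (energy_ne_top_of_mem_BHDp hp0 h.2)
        (energy_ne_top_of_mem_BHDp hp0 h'.2)
    have he := ellp_subset_closureDp (S := S) hp.le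
      (comp_sub_mem_ellp hp.le hS (hasBoundedFibers_id G) hψφ hE)
    have := closureDp_sub_mem hp.le hd' he
    refine Subtype.ext (eq_of_sub_mem_closureDp hp hS h1G h.2 h'.2 ?_)
    -- Composing with `φ` returns `h - h'` up to an `ℓ^p` error, since `ψ ∘ φ` is at bounded
    -- distance from the identity.
    have heq : (h - h' : G → ℂ) = ((h - h' : G → ℂ) ∘ ψ) ∘ φ -
        ((h - h' : G → ℂ) ∘ (fun x => ψ (φ x)) - (h - h' : G → ℂ) ∘ fun x => x) := by
      ext g
      simp only [Pi.sub_apply, Function.comp_apply]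
      ring
    rw [heq]
    exact this
  · intro k
    -- The preimage of `k` is the harmonic part of `k ∘ φ`: modulo the closure, `h ∘ ψ` agrees with
    -- `k ∘ φ ∘ ψ` and hence with `k`.
    obtain ⟨h, hh, hd⟩ := exists_harmonic_sub_mem hp hS
      (hφ.comp_mem_BDp hp.le hT (mem_BDp_of_mem_BHDp k.2))
    refine ⟨⟨h, hh⟩, Subtype.ext (eq_of_sub_mem_closureDp hp hT h1 (Φ ⟨h, hh⟩).2 k.2 ?_)⟩
    have he := ellp_subset_closureDp (S := T) hp.le
      (comp_sub_mem_ellp hp.le hT (hasBoundedFibers_id H) hφψ (energy_ne_top_of_mem_BHDp hp0 k.2))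
    have := closureDp_sub_mem hp.le
      (closureDp_sub_mem hp.le he (hψ.comp_mem_closureDp hp.le hS hd)) (hΦ ⟨h, hh⟩)
    have heq : (Φ ⟨h, hh⟩ : H → ℂ) - k =
        ((k : H → ℂ) ∘ (fun y => φ (ψ y)) - (k : H → ℂ) ∘ fun y => y) -
        ((k : H → ℂ) ∘ φ - h) ∘ ψ - (h ∘ ψ - Φ ⟨h, hh⟩) := by
      ext y
      simp only [Pi.sub_apply, Function.comp_apply]
      ring
    rw [heq]
    exact this

end HarmonicPart

end PHarmonic

/-! ### The main theorem -/

theorem theorem2p4 {G H : Type*} [Group G] [Group H] [Infinite G] [Infinite H]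
    (S : Finset G) (T : Finset H) (hS : IsSymmGenSet S) (hT : IsSymmGenSet T)
    (p : ℝ) (hp : 1 < p)
    (φ : G → H) (hφ : IsRoughIsometry (wordDist S) (wordDist T) φ) :
    (∃ ψ : H → G, IsRoughInverse (wordDist S) (wordDist T) φ ψ) ∧
    ∃ Φ : BHDp p S → BHDp p T, Function.Bijective Φ ∧
      ∀ ψ : H → G, IsRoughInverse (wordDist S) (wordDist T) φ ψ →
        ∀ h : BHDp p S,
          (h : G → ℂ) ∘ ψ ∈ BDp p T ∧
          IsHarmonicPart p T ((h : G → ℂ) ∘ ψ) (Φ h) ∧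
          ((1 : H → ℂ) ∉ BfinSuppClosure p T →
            ∀ h' : H → ℂ, IsHarmonicPart p T ((h : G → ℂ) ∘ ψ) h' → h' = Φ h) := by
  have hp0 : 0 ≤ p := by linarith
  have hφc : IsCoarseMap S φ := hφ.isCoarseMap hS hT
  have hcoarse : ∀ {ψ : H → G}, IsRoughInverse (wordDist S) (wordDist T) φ ψ → IsCoarseMap T ψ :=
    fun hψ => IsRoughIsometry.isCoarseMap hT hS hψ.1
  have hBD : ∀ {ψ : H → G}, IsRoughInverse (wordDist S) (wordDist T) φ ψ → ∀ h : BHDp p S,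
      (h : G → ℂ) ∘ ψ ∈ BDp p T :=
    fun hψ h => (hcoarse hψ).comp_mem_BDp hp.le hS (mem_BDp_of_mem_BHDp h.2)
  obtain ⟨ψ₀, hψ₀⟩ := hφ.exists_isRoughInverse hT
  refine ⟨⟨ψ₀, hψ₀⟩, ?_⟩
  rw [one_mem_BfinSuppClosure_iff]
  by_cases h1 : (1 : H → ℂ) ∈ closureDp p T (finSupp H)
  · have h1G : (1 : G → ℂ) ∈ closureDp p S (finSupp G) :=
      hφc.one_mem_closureDp hp.le hT h1
    have hconst := fun h : BHDp p S => eq_const_of_one_mem hp hS h1G h.2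
    -- All bounded harmonic functions on both groups are constant, so `Φ` carries over the value,
    -- and `h ∘ ψ` is its own harmonic part.
    refine ⟨fun h => ⟨fun _ => (h : G → ℂ) 1, const_mem_BHDp (by linarith) _⟩, ⟨?_, ?_⟩,
      fun ψ hψ h => ⟨hBD hψ h, ?_, fun h' => absurd h1 h'⟩⟩
    · intro h h' hh
      ext g
      rw [hconst h, hconst h']
      exact congrFun (congrArg Subtype.val hh) 1
    · intro k
      refine ⟨⟨fun _ => (k : H → ℂ) 1, const_mem_BHDp (by linarith) _⟩, ?_⟩
      ext y
      exact (eq_const_of_one_mem hp hT h1 k.2 y).symm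
    · refine (isHarmonicPart_iff hp.le (hBD hψ h).2).2 ⟨const_mem_BHDp (by linarith) _, ?_⟩
      have heq : (h : G → ℂ) ∘ ψ - (fun _ => (h : G → ℂ) 1) = 0 := by
        ext y
        rw [Pi.sub_apply, Function.comp_apply, hconst h (ψ y), sub_self, Pi.zero_apply]
      rw [heq]
      exact zero_mem_closureDp hp.le
  · choose Φ hΦ hΦd using fun h : BHDp p S => exists_harmonic_sub_mem hp hT (hBD hψ₀ h)
    obtain ⟨-, a, b, c, -, hψφ, hφψ⟩ := id hψ₀
    -- `Φ` is built from the single rough inverse `ψ₀`. Any other is at bounded distance from it, so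
    -- `h ∘ ψ` and `h ∘ ψ₀` differ by an `ℓ^p` function.
    have hpart : ∀ {ψ : H → G}, IsRoughInverse (wordDist S) (wordDist T) φ ψ → ∀ h : BHDp p S,
        (h : G → ℂ) ∘ ψ - Φ h ∈ closureDp p T (finSupp H) := by
      intro ψ hψ h
      obtain ⟨r, hr⟩ := hψ₀.exists_wordDist_le hT hψ
      have he := ellp_subset_closureDp (S := T) hp.le (comp_sub_mem_ellp hp.le hS
        (hcoarse hψ₀).fibers hr (energy_ne_top_of_mem_BHDp hp0 h.2))
      have := closureDp_add_mem hp.le he (hΦd h)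
      rwa [sub_add_sub_cancel] at this
    refine ⟨fun h => ⟨Φ h, hΦ h⟩, bijective_of_comp_sub_mem hp hS hT h1 hφc (hcoarse hψ₀)
      hψφ hφψ hΦd, fun ψ hψ h => ⟨hBD hψ h, ?_, fun _ h' hh' => ?_⟩⟩
    · exact (isHarmonicPart_iff hp.le (hBD hψ h).2).2 ⟨hΦ h, hpart hψ h⟩
    · obtain ⟨hh', hd'⟩ := (isHarmonicPart_iff hp.le (hBD hψ h).2).1 hh'
      refine eq_of_sub_mem_closureDp hp hT h1 hh' (hΦ h) ?_
      have := closureDp_sub_mem hp.le (hpart hψ h) hd'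
      rwa [sub_sub_sub_cancel_left] at this
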